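/- All graphs are finite, undirected and simple. For a graph $G$ and a positive integer $t$ let $$\sigma_t(G)=\min\Big\{\sum_{x\in X} d_G(x) \;:\; X\subseteq V(G) \text{ is an independent set of } G \text{ with } |X|=t\Big\},$$ where $\sigma_t(G)=\infty$ if $G$ has no independent set of size $t$. Let $k\ge 2$ and $t\ge 5$ be integers. (1) If $G$ is a graph with $|V(G)|\ge (2t-1)k$ and $\sigma_t(G)\ge 2kt-t+1$, then $G$ contains $k$ pairwise vertex-disjoint cycles. (2) The degree sum bound in (1) is sharp: for every integer $m\ge t$, let $G_m=K_{2k-1}+mK_1$ be the join of the complete graph on $2k-1$ vertices with the edgeless graph on $m$ vertices (all edges between the two parts are present). Then $\sigma_t(G_m)=2kt-t$, and $G_m$ does not contain $k$ pairwise vertex-disjoint cycles. -/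

import Mathlib

namespace DisjointCycles

open Classical in
/-- The minimum degree sum `σ_t(G)` of `t` pairwise non-adjacent vertices. It lives in `ℕ∞`, and
it is `⊤` (the minimum over the empty family) when `G` has no independent set of size `t`. -/
noncomputable def sigma {V : Type*} [Fintype V] (G : SimpleGraph V) (t : ℕ) : ℕ∞ :=
  ⨅ X : {X : Finset V // G.IsNIndepSet t X}, ((∑ x ∈ X.1, G.degree x : ℕ) : ℕ∞)

/-- `G` contains `k` pairwise vertex-disjoint cycles. -/
def HasDisjointCycles {V : Type*} (G : SimpleGraph V) (k : ℕ) : Prop :=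
  ∃ (v : Fin k → V) (c : ∀ i, G.Walk (v i) (v i)),
    (∀ i, (c i).IsCycle) ∧
      ∀ i j, i ≠ j → List.Disjoint (c i).support (c j).support

/-- The join `G + H`: the disjoint union of `G` and `H` together with all edges between them. -/
def join {V W : Type*} (G : SimpleGraph V) (H : SimpleGraph W) : SimpleGraph (V ⊕ W) :=
  (G.sum H) ⊔ completeBipartiteGraph V W

/-- The graph `K_n + m K_1`. -/
def completeJoinEmpty (n m : ℕ) : SimpleGraph (Fin n ⊕ Fin m) :=
  join (⊤ : SimpleGraph (Fin n)) (⊥ : SimpleGraph (Fin m))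

end DisjointCycles

/-! Suppose a packing of `j < k` disjoint cycles cannot be enlarged. Choose it with as few vertices
as possible and, subject to that, with as many edges as possible among the vertices left over
(`IsOptimal`). The leftover graph `H` is then a forest, every member of the packing is an induced
cycle, and three kinds of exchange are ruled out: shortening one cycle, shortening two at once, and
swapping a cycle vertex for a vertex of `H` so that `H` gains edges.

The degree condition is used through averages: if every independent `t`-set in a family has degree
sum at least `c`, and the family covers a set evenly, then the mean degree on that set is at least
`c / t`, which exceeds `2j + 1`. Applied to a cycle with at least `2t` vertices, this makes `H`
large; without such a cycle the bound on `|V|` does (`card_rest`). Applied to the larger colour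
class of `H`, it yields a cycle with at most four vertices (`exists_card_le_four`), whence `|H| ≥ 4t
- 6`.

Let `Λ` be the sum of the deficits `2 - d` over the vertices of degree `d ≤ 2` in `H`, and let `W`
be the set of these vertices, `N = |W|`. The leaves of `H` give `Λ ≤ 2t - 2` and at most `t - 3`
branch vertices, so `N ≥ 2t + 1`. The set `W` sends `2N - Λ` edges into `H` and at most `N + Λ + 2`
to each cycle (`edgePairs_le_add_leafWeight`), too few for mean degree `c / t`.

Cycles are handled as vertex sets containing a subset of minimum degree two, which edge counting
detects. Since `edgePairs G S S` counts each edge twice, `2 * #S ≤ edgePairs G S S + 2` says that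
`S` spans at least `|S| - 1` edges. -/

namespace DisjointCycles

open Classical Finset

/-! ### Degrees into sets, acyclic sets and averaging -/

section

variable {V : Type*}

/-- The number of neighbours of `v` in `S`. -/
noncomputable def dIn (G : SimpleGraph V) (S : Finset V) (v : V) : ℕ := #{w ∈ S | G.Adj v w}

/-- The number of pairs of adjacent vertices in `S × T`. -/
noncomputable def edgePairs (G : SimpleGraph V) (S T : Finset V) : ℕ := ∑ v ∈ S, dIn G T v

/-- `S` contains the vertex set of a subgraph of minimum degree at least two. -/
def Cyclic (G : SimpleGraph V) (S : Finset V) : Prop :=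
  ∃ S' ⊆ S, S'.Nonempty ∧ ∀ v ∈ S', 2 ≤ dIn G S' v

/-- No two vertices of `X` are adjacent. -/
def Indep (G : SimpleGraph V) (X : Finset V) : Prop := ∀ x ∈ X, ∀ y ∈ X, ¬ G.Adj x y

variable {G : SimpleGraph V} {S T A B X : Finset V} {v w x : V}

lemma Indep.mono (h : Indep G T) (hS : S ⊆ T) : Indep G S :=
  fun x hx y hy => h x (hS hx) y (hS hy)

lemma Cyclic.mono (h : Cyclic G S) (hS : S ⊆ T) : Cyclic G T := by
  obtain ⟨S', h1, h2⟩ := h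
  exact ⟨S', h1.trans hS, h2⟩

lemma Cyclic.nonempty (h : Cyclic G S) : S.Nonempty := by
  obtain ⟨S', h1, h2, _⟩ := h
  exact h2.mono h1

lemma dIn_mono (h : S ⊆ T) (v : V) : dIn G S v ≤ dIn G T v :=
  card_le_card (filter_subset_filter _ h)

lemma dIn_le_card (S : Finset V) (v : V) : dIn G S v ≤ #S := card_filter_le _ _

lemma dIn_union (h : Disjoint S T) (v : V) : dIn G (S ∪ T) v = dIn G S v + dIn G T v := by
  unfold dIn
  rw [filter_union, card_union_of_disjoint (disjoint_filter_filter h)]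

lemma dIn_insert (h : w ∉ S) (v : V) :
    dIn G (insert w S) v = dIn G S v + if G.Adj v w then 1 else 0 := by
  unfold dIn
  rw [filter_insert]
  split_ifs with hvw
  · rw [card_insert_of_notMem (by simp [h])]
  · rfl

lemma dIn_singleton (v w : V) : dIn G {w} v = if G.Adj v w then 1 else 0 := by
  unfold dIn
  rw [filter_singleton]
  split_ifs <;> simp

lemma dIn_erase_add (h : w ∈ S) (v : V) :
    dIn G (S.erase w) v + (if G.Adj v w then 1 else 0) = dIn G S v := by
  conv_rhs => rw [← insert_erase h]
  rw [dIn_insert (notMem_erase _ _)]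

lemma dIn_erase_self (S : Finset V) (v : V) : dIn G (S.erase v) v = dIn G S v := by
  by_cases h : v ∈ S
  · have := dIn_erase_add (G := G) h v
    simpa using this
  · rw [erase_eq_of_notMem h]

lemma dIn_le_erase_add_one (S : Finset V) (v w : V) :
    dIn G S v ≤ dIn G (S.erase w) v + 1 := by
  by_cases h : w ∈ S
  · have := dIn_erase_add (G := G) h v
    split_ifs at this <;> omega
  · rw [erase_eq_of_notMem h]; omega

lemma dIn_eq_sum (S : Finset V) (v : V) :
    dIn G S v = ∑ w ∈ S, if G.Adj v w then 1 else 0 := by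
  unfold dIn
  rw [card_filter]

lemma dIn_pos_iff : 0 < dIn G S v ↔ ∃ w ∈ S, G.Adj v w := by
  unfold dIn
  rw [card_pos]
  constructor
  · rintro ⟨w, hw⟩
    exact ⟨w, by simpa using hw⟩
  · rintro ⟨w, hw⟩
    exact ⟨w, by simpa using hw⟩

lemma dIn_eq_zero_iff : dIn G S v = 0 ↔ ∀ w ∈ S, ¬ G.Adj v w := by
  unfold dIn
  rw [card_eq_zero, filter_eq_empty_iff]

lemma two_le_dIn_iff :
    2 ≤ dIn G S v ↔ ∃ a ∈ S, ∃ b ∈ S, a ≠ b ∧ G.Adj v a ∧ G.Adj v b := by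
  unfold dIn
  rw [Nat.succ_le_iff, one_lt_card]
  constructor
  · rintro ⟨a, ha, b, hb, hab⟩
    simp only [mem_filter] at ha hb
    exact ⟨a, ha.1, b, hb.1, hab, ha.2, hb.2⟩
  · rintro ⟨a, ha, b, hb, hab, h1, h2⟩
    exact ⟨a, by simp [ha, h1], b, by simp [hb, h2], hab⟩

lemma edgePairs_comm (S T : Finset V) : edgePairs G S T = edgePairs G T S := by
  unfold edgePairs
  simp only [dIn_eq_sum]
  rw [sum_comm]
  simp only [G.adj_comm]

lemma edgePairs_union_left (h : Disjoint S T) (X : Finset V) :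
    edgePairs G (S ∪ T) X = edgePairs G S X + edgePairs G T X := sum_union h

lemma edgePairs_union_right (h : Disjoint S T) (X : Finset V) :
    edgePairs G X (S ∪ T) = edgePairs G X S + edgePairs G X T := by
  rw [edgePairs_comm, edgePairs_union_left h, edgePairs_comm, edgePairs_comm T]

lemma edgePairs_singleton_left (v : V) (S : Finset V) : edgePairs G {v} S = dIn G S v :=
  sum_singleton _ _

lemma edgePairs_union_self (h : Disjoint S T) :
    edgePairs G (S ∪ T) (S ∪ T) = edgePairs G S S + edgePairs G T T + 2 * edgePairs G S T := by
  rw [edgePairs_union_left h, edgePairs_union_right h, edgePairs_union_right h,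
    edgePairs_comm T S]
  ring

lemma edgePairs_insert_self (h : v ∉ S) :
    edgePairs G (insert v S) (insert v S) = edgePairs G S S + 2 * dIn G S v := by
  rw [insert_eq, edgePairs_union_self (by simpa using h), edgePairs_singleton_left,
    edgePairs_singleton_left]
  simp [dIn_singleton]

lemma edgePairs_erase_self (h : v ∈ S) :
    edgePairs G (S.erase v) (S.erase v) + 2 * dIn G S v = edgePairs G S S := by
  conv_rhs => rw [← insert_erase h]
  rw [edgePairs_insert_self (notMem_erase _ _), dIn_erase_self]

lemma exists_dIn_le_one (h : ¬ Cyclic G S) (hT : T ⊆ S) (hne : T.Nonempty) :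
    ∃ v ∈ T, dIn G T v ≤ 1 := by
  by_contra! hc
  exact h ⟨T, hT, hne, fun v hv => hc v hv⟩

lemma edgePairs_add_two_le (h : ¬ Cyclic G S) (hne : S.Nonempty) :
    edgePairs G S S + 2 ≤ 2 * #S := by
  induction S using Finset.strongInduction with
  | H S ih =>
    obtain ⟨v, hv, hd⟩ := exists_dIn_le_one h subset_rfl hne
    have h1 := edgePairs_erase_self (G := G) hv
    have h2 := card_erase_add_one hv
    rcases (S.erase v).eq_empty_or_nonempty with h0 | h0
    · have h3 := dIn_erase_self (G := G) S v
      rw [h0] at h1 h2 h3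
      simp [edgePairs, dIn] at h1 h2 h3
      simp only [edgePairs, dIn]
      omega
    · have := ih _ (erase_ssubset hv) (fun hc => h (hc.mono (erase_subset _ _))) h0
      omega

lemma cyclic_of_edgePairs (hne : S.Nonempty) (h : 2 * #S ≤ edgePairs G S S) : Cyclic G S := by
  by_contra hc
  have := edgePairs_add_two_le hc hne
  omega

/-- With `|S| + 1` edges some vertex is superfluous: deleting one of degree at most two leaves
enough edges for a cycle, and if all degrees are at least three, deleting any vertex keeps minimum
degree two. -/
lemma exists_ssubset_cyclic (h : 2 * #S + 2 ≤ edgePairs G S S) :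
    ∃ T ⊂ S, Cyclic G T := by
  have hne : S.Nonempty := by
    by_contra h0
    rw [not_nonempty_iff_eq_empty] at h0
    subst h0
    simp [edgePairs] at h
  have herase : ∀ v ∈ S, (S.erase v).Nonempty := by
    intro v hv
    by_contra h0
    rw [not_nonempty_iff_eq_empty] at h0
    have h1 := edgePairs_erase_self (G := G) hv
    have h3 := dIn_erase_self (G := G) S v
    rw [h0] at h1 h3
    simp [edgePairs, dIn] at h h1 h3
    omega
  by_cases hd : ∃ v ∈ S, dIn G S v ≤ 2
  · obtain ⟨v, hv, hd⟩ := hd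
    refine ⟨S.erase v, erase_ssubset hv, cyclic_of_edgePairs (herase v hv) ?_⟩
    have h1 := edgePairs_erase_self (G := G) hv
    have h2 := card_erase_add_one hv
    omega
  · push Not at hd
    obtain ⟨v, hv⟩ := hne
    refine ⟨S.erase v, erase_ssubset hv, S.erase v, subset_rfl, herase v hv, fun w hw => ?_⟩
    have := hd w (mem_of_mem_erase hw)
    have := dIn_le_erase_add_one (G := G) S w v
    omega

/-- A set that spans at least `|A| - 1` edges, together with a vertex that has two neighbours
in it, contains a cycle. -/
lemma cyclic_insert (hA : 2 * #A ≤ edgePairs G A A + 2) (hv : v ∉ A) (hd : 2 ≤ dIn G A v) :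
    Cyclic G (insert v A) := by
  apply cyclic_of_edgePairs (insert_nonempty _ _)
  rw [edgePairs_insert_self hv, card_insert_of_notMem hv]
  omega

/-- A set of `t` or more numbers whose `t`-subsets have sum at least `c` has average at least
`c / t`. -/
lemma mul_card_le_of_forall_subset {t c : ℕ} (ht : 1 ≤ t) (f : V → ℕ) (A : Finset V)
    (hA : t ≤ #A) (h : ∀ X ⊆ A, #X = t → c ≤ ∑ x ∈ X, f x) :
    #A * c ≤ t * ∑ x ∈ A, f x := by
  induction hn : #A - t generalizing A with
  | zero =>
    have : #A = t := by omega
    rw [this]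
    exact Nat.mul_le_mul_left _ (h A subset_rfl this)
  | succ n ih =>
    have h1 : ∀ v ∈ A, (#A - 1) * c ≤ t * ∑ x ∈ A.erase v, f x := by
      intro v hv
      have hc := card_erase_of_mem hv
      rw [← hc]
      exact ih (A.erase v) (by omega) (fun X hX => h X (hX.trans (erase_subset _ _))) (by omega)
    have h2 := sum_le_sum h1
    have h3 : ∑ v ∈ A, t * ∑ x ∈ A.erase v, f x = (#A - 1) * (t * ∑ x ∈ A, f x) := by
      rw [← mul_sum]
      -- Each element is missing from exactly one of the sets `A.erase v`, so it is counted `|A| -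
      -- 1` times.
      have : ∑ v ∈ A, ∑ x ∈ A.erase v, f x + ∑ v ∈ A, f v = #A * ∑ x ∈ A, f x := by
        rw [← sum_add_distrib, sum_congr rfl (fun v hv => sum_erase_add A f hv)]
        simp
      obtain ⟨m, hm⟩ : ∃ m, #A = m + 1 := ⟨#A - 1, by omega⟩
      rw [hm] at this ⊢
      simp only [Nat.add_sub_cancel]
      have h4 : ∑ v ∈ A, ∑ x ∈ A.erase v, f x = m * ∑ x ∈ A, f x := by linarith
      rw [h4]; ring
    rw [h3, sum_const, smul_eq_mul] at h2
    have h5 : 0 < #A - 1 := by omega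
    refine le_of_mul_le_mul_left (a := #A - 1) ?_ h5
    linarith

/-- An acyclic set is the union of two independent sets. -/
lemma exists_bipartition (h : ¬ Cyclic G S) :
    ∃ A B, Disjoint A B ∧ A ∪ B = S ∧ Indep G A ∧ Indep G B := by
  induction S using Finset.strongInduction with
  | H S ih =>
    rcases S.eq_empty_or_nonempty with rfl | hne
    · exact ⟨∅, ∅, by simp, by simp, by simp [Indep], by simp [Indep]⟩
    obtain ⟨v, hv, hd⟩ := exists_dIn_le_one h subset_rfl hne
    obtain ⟨A, B, hAB, hU, hA, hB⟩ :=
      ih _ (erase_ssubset hv) (fun hc => h (hc.mono (erase_subset _ _)))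
    have hvU : v ∉ A ∪ B := by rw [hU]; exact notMem_erase _ _
    rw [mem_union, not_or] at hvU
    have key : ∀ A B : Finset V, Disjoint A B → A ∪ B = S.erase v → v ∉ A → v ∉ B → Indep G A →
        Indep G B → dIn G A v = 0 →
        ∃ A B, Disjoint A B ∧ A ∪ B = S ∧ Indep G A ∧ Indep G B := by
      intro A B hAB hU hvA hvB hA hB h0
      rw [dIn_eq_zero_iff] at h0
      refine ⟨insert v A, B, by simp [hAB, hvB], ?_, ?_, hB⟩
      · rw [insert_union, hU, insert_erase hv]
      · intro x hx y hy
        rw [mem_insert] at hx hy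
        rcases hx with rfl | hx <;> rcases hy with rfl | hy
        · simp
        · exact h0 _ hy
        · exact fun hc => h0 _ hx hc.symm
        · exact hA _ hx _ hy
    have hsum : dIn G A v + dIn G B v ≤ 1 := by
      rw [← dIn_union hAB, hU, dIn_erase_self]; exact hd
    rcases Nat.eq_zero_or_pos (dIn G A v) with h0 | h0
    · exact key A B hAB hU hvU.1 hvU.2 hA hB h0
    · exact key B A hAB.symm (by rw [union_comm, hU]) hvU.2 hvU.1 hB hA (by omega)

/-- An acyclic set of maximum degree at most two has a balanced bipartition. -/
lemma exists_balanced_bipartition (h : ¬ Cyclic G S) (hd2 : ∀ v ∈ S, dIn G S v ≤ 2) :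
    ∃ A B, Disjoint A B ∧ A ∪ B = S ∧ Indep G A ∧ Indep G B ∧ #B ≤ #A ∧ #A ≤ #B + 1 := by
  induction S using Finset.strongInduction with
  | H S ih =>
    rcases S.eq_empty_or_nonempty with rfl | hne
    · exact ⟨∅, ∅, by simp, by simp, by simp [Indep], by simp [Indep], by simp, by simp⟩
    obtain ⟨v, hv, hd⟩ := exists_dIn_le_one h subset_rfl hne
    rcases Nat.eq_zero_or_pos (dIn G S v) with h0 | h0
    · obtain ⟨A, B, hAB, hU, hA, hB, h1, h2⟩ :=
        ih _ (erase_ssubset hv) (fun hc => h (hc.mono (erase_subset _ _)))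
          (fun w hw => (dIn_mono (erase_subset _ _) w).trans (hd2 w (mem_of_mem_erase hw)))
      have hvU : v ∉ A ∪ B := by rw [hU]; exact notMem_erase _ _
      rw [mem_union, not_or] at hvU
      have hBS : B ⊆ S := (subset_union_right.trans hU.subset).trans (erase_subset _ _)
      rw [dIn_eq_zero_iff] at h0
      have hB' : Indep G (insert v B) := by
        intro x hx y hy
        rw [mem_insert] at hx hy
        rcases hx with rfl | hx <;> rcases hy with rfl | hy
        · simp
        · exact h0 _ (hBS hy)
        · exact fun hc => h0 _ (hBS hx) hc.symm
        · exact hB _ hx _ hy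
      have hc : #(insert v B) = #B + 1 := card_insert_of_notMem hvU.2
      have hU' : A ∪ insert v B = S := by rw [union_insert, hU, insert_erase hv]
      have hD' : Disjoint A (insert v B) := by simp [hAB, hvU.1]
      by_cases hEq : #A = #B
      · exact ⟨insert v B, A, hD'.symm, by rw [union_comm, hU'], hB', hA, by omega, by omega⟩
      · exact ⟨A, insert v B, hD', hU', hA, hB', by omega, by omega⟩
    · obtain ⟨u, huS, hvu⟩ := dIn_pos_iff.1 h0
      have huv : u ≠ v := fun hc => G.ne_of_adj hvu hc.symm
      have hvonly : ∀ w ∈ S, G.Adj v w → w = u := by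
        intro w hw hvw
        by_contra hne
        have := two_le_dIn_iff.2 ⟨w, hw, u, huS, hne, hvw, hvu⟩
        omega
      -- A leaf and its neighbour are removed together and put into opposite classes, which
      -- preserves the balance. Having lost `v`, the vertex `u` keeps at most one neighbour, so one
      -- of the classes can take it.
      set R := (S.erase v).erase u with hR
      have hRS : R ⊆ S := (erase_subset _ _).trans (erase_subset _ _)
      have hRss : R ⊂ S := (erase_subset _ _).trans_ssubset (erase_ssubset hv)
      obtain ⟨A, B, hAB, hU, hA, hB, h1, h2⟩ :=
        ih R hRss (fun hc => h (hc.mono hRS))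
          (fun w hw => (dIn_mono hRS w).trans (hd2 w (hRS hw)))
      have hvR : v ∉ A ∪ B := by rw [hU, hR]; simp
      have huR : u ∉ A ∪ B := by rw [hU, hR]; simp
      rw [mem_union, not_or] at hvR huR
      have hAS : A ⊆ S := (subset_union_left.trans hU.subset).trans hRS
      have hBS : B ⊆ S := (subset_union_right.trans hU.subset).trans hRS
      have huR1 : dIn G R u ≤ 1 := by
        have e1 := dIn_erase_self (G := G) (S.erase v) u
        have e2 := dIn_erase_add (G := G) hv u
        have e3 := hd2 u huS
        rw [if_pos hvu.symm] at e2
        rw [hR, e1]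
        omega
      have hsum : dIn G A u + dIn G B u ≤ 1 := by
        rw [← dIn_union hAB, hU]; exact huR1
      have indep_insert_u : ∀ A : Finset V, Indep G A → dIn G A u = 0 → Indep G (insert u A) := by
        intro A hA h0
        rw [dIn_eq_zero_iff] at h0
        intro x hx y hy
        rw [mem_insert] at hx hy
        rcases hx with rfl | hx <;> rcases hy with rfl | hy
        · simp
        · exact h0 _ hy
        · exact fun hc => h0 _ hx hc.symm
        · exact hA _ hx _ hy
      have indep_insert_v : ∀ A : Finset V, A ⊆ S → u ∉ A → Indep G A → Indep G (insert v A) := by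
        intro A hAS huA hA x hx y hy
        rw [mem_insert] at hx hy
        rcases hx with rfl | hx <;> rcases hy with rfl | hy
        · simp
        · exact fun hc => huA (hvonly y (hAS hy) hc ▸ hy)
        · exact fun hc => huA (hvonly x (hAS hx) hc.symm ▸ hx)
        · exact hA _ hx _ hy
      have hS : insert v (insert u R) = S := by
        rw [hR, insert_erase (mem_erase.2 ⟨huv, huS⟩), insert_erase hv]
      rcases Nat.eq_zero_or_pos (dIn G A u) with h0 | h0
      · refine ⟨insert u A, insert v B, ?_, ?_, indep_insert_u A hA h0,
          indep_insert_v B hBS huR.2 hB, ?_, ?_⟩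
        · simp [hAB, huR.2, hvR.1, huv.symm]
        · rw [union_insert, insert_union, hU, hS]
        · rw [card_insert_of_notMem huR.1, card_insert_of_notMem hvR.2]; omega
        · rw [card_insert_of_notMem huR.1, card_insert_of_notMem hvR.2]; omega
      · refine ⟨insert v A, insert u B, ?_, ?_, indep_insert_v A hAS huR.1 hA,
          indep_insert_u B hB (by omega), ?_, ?_⟩
        · simp [hAB, huR.1, hvR.2, huv]
        · rw [insert_union, union_insert, hU, hS]
        · rw [card_insert_of_notMem hvR.1, card_insert_of_notMem huR.2]; omega
        · rw [card_insert_of_notMem hvR.1, card_insert_of_notMem huR.2]; omega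

end

/-! ### Cycles as vertex sets: cyclic orders, arcs and rotations -/

section

variable {V : Type*} {G : SimpleGraph V} {S T A B X : Finset V} {v w x : V}

lemma two_le_dIn_support {c : G.Walk v v} (hc : c.IsCycle) (hw : w ∈ c.support) :
    2 ≤ dIn G c.support.toFinset w := by
  have h2 := hc.ncard_neighborSet_toSubgraph_eq_two hw
  rw [Set.ncard_eq_two] at h2
  obtain ⟨a, b, hab, hN⟩ := h2
  have ha : a ∈ c.toSubgraph.neighborSet w := by rw [hN]; simp
  have hb : b ∈ c.toSubgraph.neighborSet w := by rw [hN]; simp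
  rw [SimpleGraph.Subgraph.mem_neighborSet] at ha hb
  refine two_le_dIn_iff.2 ⟨a, ?_, b, ?_, hab, ha.adj_sub, hb.adj_sub⟩
  · simpa using (c.mem_verts_toSubgraph).1 ha.snd_mem
  · simpa using (c.mem_verts_toSubgraph).1 hb.snd_mem

lemma cyclic_support {c : G.Walk v v} (hc : c.IsCycle) : Cyclic G c.support.toFinset :=
  ⟨_, subset_rfl, ⟨v, by simp⟩, fun w hw => two_le_dIn_support hc (by simpa using hw)⟩

/-- If the induced graph on `S'` were acyclic it would lie in a tree on `S'`. A leaf of that tree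
would have at most one neighbour in `S'`, against minimum degree two. -/
lemma Cyclic.exists_isCycle (h : Cyclic G S) :
    ∃ (v : V) (c : G.Walk v v), c.IsCycle ∧ ∀ w ∈ c.support, w ∈ S := by
  obtain ⟨S', hS, hne, hd⟩ := h
  have hnot : ¬ (G.induce (S' : Set V)).IsAcyclic := by
    intro hac
    have : Nonempty (S' : Set V) := ⟨⟨hne.choose, hne.choose_spec⟩⟩
    obtain ⟨T, hFT, -, hT⟩ :=
      SimpleGraph.connected_top.exists_isTree_le_of_le_of_isAcyclic le_top hac
    have hcard : 1 < #S' := by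
      obtain ⟨x, hx⟩ := hne
      have := (hd x hx).trans (dIn_le_card S' x)
      omega
    have : Nontrivial (S' : Set V) := by
      obtain ⟨a, ha, b, hb, hab⟩ := one_lt_card.1 hcard
      exact ⟨⟨⟨a, ha⟩, ⟨b, hb⟩, by simpa using hab⟩⟩
    obtain ⟨⟨u, hu⟩, hdeg⟩ := hT.exists_vert_degree_one_of_nontrivial
    obtain ⟨a, ha, b, hb, hab, hua, hub⟩ := two_le_dIn_iff.1 (hd u hu)
    rw [SimpleGraph.degree_eq_one_iff_existsUnique_adj] at hdeg
    have h1 : T.Adj ⟨u, hu⟩ ⟨a, ha⟩ := hFT (by simpa using hua)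
    have h2 : T.Adj ⟨u, hu⟩ ⟨b, hb⟩ := hFT (by simpa using hub)
    exact hab (by simpa using hdeg.unique h1 h2)
  simp only [SimpleGraph.IsAcyclic, not_forall, not_not] at hnot
  obtain ⟨v, c, hc⟩ := hnot
  refine ⟨_, c.map (SimpleGraph.Embedding.induce (S' : Set V)).toHom,
    hc.map (SimpleGraph.Embedding.induce (G := G) (S' : Set V)).injective, fun w hw => ?_⟩
  rw [SimpleGraph.Walk.support_map, List.mem_map] at hw
  obtain ⟨⟨z, hz⟩, -, rfl⟩ := hw
  exact hS hz

/-- `f` runs periodically around a closed walk with vertex set `S` that visits each vertex once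
per period. -/
structure IsCyclicOrder (G : SimpleGraph V) (S : Finset V) (f : ℕ → V) : Prop where
  adj : ∀ i, G.Adj (f i) (f (i + 1))
  eq_iff : ∀ i j, f i = f j ↔ i ≡ j [MOD #S]
  image : (range #S).image f = S

lemma exists_isCyclicOrder_of_isCycle {c : G.Walk v v} (hc : c.IsCycle) :
    ∃ f, IsCyclicOrder G c.support.toFinset f := by
  have hL := hc.three_le_length
  have hinj := hc.getVert_injOn'
  have himg : (range c.length).image (fun i => c.getVert (i % c.length)) =
      c.support.toFinset := by
    ext w
    simp only [mem_image, mem_range, List.mem_toFinset]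
    constructor
    · rintro ⟨i, -, rfl⟩
      exact c.getVert_mem_support _
    · intro hw
      obtain ⟨n, hn, hle⟩ := SimpleGraph.Walk.mem_support_iff_exists_getVert.1 hw
      rcases hle.lt_or_eq with hlt | rfl
      · exact ⟨n, hlt, by rw [Nat.mod_eq_of_lt hlt, hn]⟩
      · refine ⟨0, by omega, ?_⟩
        rw [← hn]
        simp
  have hinj' : ∀ i j, c.getVert (i % c.length) = c.getVert (j % c.length) →
      i % c.length = j % c.length := by
    intro i j hij
    have h1 := Nat.mod_lt i (y := c.length) (by omega)
    have h2 := Nat.mod_lt j (y := c.length) (by omega)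
    exact hinj (by simp; omega) (by simp; omega) hij
  have hcard : #c.support.toFinset = c.length := by
    rw [← himg, card_image_of_injOn, card_range]
    intro i hi j hj hij
    have := hinj' i j hij
    simp only [coe_range, Set.mem_Iio] at hi hj
    rwa [Nat.mod_eq_of_lt hi, Nat.mod_eq_of_lt hj] at this
  refine ⟨fun i => c.getVert (i % c.length), fun i => ?_, fun i j => ?_, by rw [hcard, himg]⟩
  · have h1 := Nat.mod_lt i (y := c.length) (by omega)
    have h2 := c.adj_getVert_succ h1
    have h3 : c.getVert ((i + 1) % c.length) = c.getVert (i % c.length + 1) := by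
      rcases (show i % c.length + 1 ≤ c.length by omega).lt_or_eq with hlt | heq
      · rw [Nat.add_mod, Nat.mod_eq_of_lt (show 1 < c.length by omega), Nat.mod_eq_of_lt hlt]
      · rw [heq, Nat.add_mod, Nat.mod_eq_of_lt (show 1 < c.length by omega), heq]
        simp
    simpa only [h3] using h2
  · rw [hcard]
    exact ⟨hinj' i j, fun h => by simp only [Nat.ModEq] at h; simp only [h]⟩

/-- A cyclic set no proper subset of which is cyclic. -/
structure MinCyclic (G : SimpleGraph V) (S : Finset V) : Prop where
  cyclic : Cyclic G S
  min : ∀ T ⊆ S, Cyclic G T → T = S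

namespace MinCyclic

variable {C : Finset V}

lemma two_le (h : MinCyclic G C) : ∀ v ∈ C, 2 ≤ dIn G C v := by
  obtain ⟨S', hS, hne, hd⟩ := h.cyclic
  obtain rfl := h.min S' hS ⟨S', subset_rfl, hne, hd⟩
  exact hd

lemma edgePairs_eq (h : MinCyclic G C) : edgePairs G C C = 2 * #C := by
  apply le_antisymm
  · by_contra! hc
    -- The count is even, so exceeding `2 * #C` means exceeding it by two, as
    -- `exists_ssubset_cyclic` requires.
    have hpar : Even (edgePairs G C C) := by
      have key : ∀ S : Finset V, Even (edgePairs G S S) := by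
        intro S
        induction S using Finset.induction_on with
        | empty => simp [edgePairs]
        | insert a S ha ih => rw [edgePairs_insert_self ha]; exact ih.add (even_two_mul _)
      exact key C
    obtain ⟨r, hr⟩ := hpar
    obtain ⟨T, hT, hcyc⟩ := exists_ssubset_cyclic (G := G) (S := C) (by omega)
    exact hT.ne (h.min T hT.subset hcyc)
  · calc 2 * #C = ∑ v ∈ C, 2 := by simp [mul_comm]
      _ ≤ edgePairs G C C := sum_le_sum h.two_le

lemma dIn_eq (h : MinCyclic G C) : ∀ v ∈ C, dIn G C v = 2 := by
  have h1 : ∑ v ∈ C, 2 = ∑ v ∈ C, dIn G C v := by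
    have := h.edgePairs_eq
    unfold edgePairs at this
    rw [this]; simp [mul_comm]
  intro v hv
  exact ((sum_eq_sum_iff_of_le h.two_le).1 h1 v hv).symm

lemma three_le_card (h : MinCyclic G C) : 3 ≤ #C := by
  obtain ⟨v, hv⟩ := h.cyclic.nonempty
  have h1 := h.two_le v hv
  rw [← dIn_erase_self] at h1
  have h2 := dIn_le_card (G := G) (C.erase v) v
  have h3 := card_erase_add_one hv
  omega

lemma edgePairs_erase (h : MinCyclic G C) (hv : v ∈ C) :
    edgePairs G (C.erase v) (C.erase v) + 4 = 2 * #C := by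
  have h1 := edgePairs_erase_self (G := G) hv
  rw [h.dIn_eq v hv, h.edgePairs_eq] at h1
  omega

lemma exists_isCyclicOrder (h : MinCyclic G C) : ∃ f, IsCyclicOrder G C f := by
  obtain ⟨v, c, hc, hs⟩ := h.cyclic.exists_isCycle
  have : c.support.toFinset = C :=
    h.min _ (fun w hw => hs w (by simpa using hw)) (cyclic_support hc)
  rw [← this]
  exact exists_isCyclicOrder_of_isCycle hc

end MinCyclic

namespace IsCyclicOrder

variable {f : ℕ → V}

lemma mem (h : IsCyclicOrder G S f) (hS : 0 < #S) (i : ℕ) : f i ∈ S := by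
  have h1 : f i = f (i % #S) := (h.eq_iff _ _).2 (Nat.mod_modEq _ _).symm
  rw [h1]
  have h2 : f (i % #S) ∈ (range #S).image f :=
    mem_image_of_mem f (mem_range.2 (Nat.mod_lt _ hS))
  rwa [h.image] at h2

lemma injOn (h : IsCyclicOrder G S f) {p q : ℕ} (hpq : q ≤ p + #S) :
    Set.InjOn f (Ico p q : Finset ℕ) := by
  have key : ∀ i j, p ≤ i → i ≤ j → j < q → f i = f j → i = j := by
    intro i j hi hij hj hf
    have h1 := (Nat.modEq_iff_dvd' hij).1 ((h.eq_iff _ _).1 hf)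
    have := Nat.eq_zero_of_dvd_of_lt h1 (by omega)
    omega
  intro i hi j hj hf
  simp only [coe_Ico, Set.mem_Ico] at hi hj
  rcases le_total i j with hij | hij
  · exact key i j hi.1 hij hj.2 hf
  · exact (key j i hj.1 hij hi.2 hf.symm).symm

lemma image_Ico (h : IsCyclicOrder G S f) (hS : 0 < #S) (p : ℕ) :
    (Ico p (p + #S)).image f = S := by
  apply eq_of_subset_of_card_le
  · intro x hx
    obtain ⟨i, -, rfl⟩ := mem_image.1 hx
    exact h.mem hS i
  · rw [card_image_of_injOn (h.injOn le_rfl)]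
    simp

/-- Along an arc each new vertex is adjacent to its predecessor. The bound on `q` keeps the vertices
of the arc distinct. -/
lemma treeLike (h : IsCyclicOrder G S f) {p q : ℕ} (hpq : q ≤ p + #S) :
    2 * #((Ico p q).image f) ≤ edgePairs G ((Ico p q).image f) ((Ico p q).image f) + 2 := by
  induction q with
  | zero => simp
  | succ q ih =>
    have ih := ih (by omega)
    rcases Nat.lt_or_ge q p with hlt | hle
    · rw [Ico_eq_empty (by omega)]; simp
    rw [show Ico p (q + 1) = insert q (Ico p q) by ext n; simp only [mem_insert, mem_Ico]; omega,
      image_insert]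
    have hnot : f q ∉ (Ico p q).image f := by
      intro hc
      obtain ⟨i, hi, hiq⟩ := mem_image.1 hc
      rw [mem_Ico] at hi
      have := h.injOn hpq (by simp; omega) (by simp; omega) hiq
      omega
    rw [edgePairs_insert_self hnot, card_insert_of_notMem hnot]
    rcases hle.eq_or_lt with rfl | hlt
    · simp
    · have : 0 < dIn G ((Ico p q).image f) (f q) := by
        refine dIn_pos_iff.2 ⟨f (q - 1), mem_image_of_mem _ (by simp; omega), ?_⟩
        have := h.adj (q - 1)
        rw [show q - 1 + 1 = q by omega] at this
        exact this.symm
      omega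

end IsCyclicOrder

/-- Two vertices split a cycle into two arcs. -/
lemma MinCyclic.exists_arcs {C : Finset V} (h : MinCyclic G C) {y z : V} (hy : y ∈ C)
    (hz : z ∈ C) (hyz : y ≠ z) :
    ∃ A B : Finset V, Disjoint A B ∧ y ∉ A ∧ y ∉ B ∧ z ∉ A ∧ z ∉ B ∧
      insert y (insert z (A ∪ B)) = C ∧
      2 * #A ≤ edgePairs G A A + 2 ∧ 2 * #B ≤ edgePairs G B B + 2 ∧
      2 * #(insert y (insert z A)) ≤
        edgePairs G (insert y (insert z A)) (insert y (insert z A)) + 2 ∧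
      2 * #(insert y (insert z B)) ≤
        edgePairs G (insert y (insert z B)) (insert y (insert z B)) + 2 := by
  obtain ⟨f, hf⟩ := h.exists_isCyclicOrder
  have h3 := h.three_le_card
  rw [← hf.image] at hy
  obtain ⟨i, hi, rfl⟩ := mem_image.1 hy
  rw [← hf.image_Ico (by omega) i] at hz
  obtain ⟨j, hj, rfl⟩ := mem_image.1 hz
  rw [mem_Ico] at hj
  have hij : i < j := lt_of_le_of_ne hj.1 (fun hc => hyz (by rw [hc]))
  have hinj := hf.injOn (p := i) (q := i + #C) le_rfl
  -- The second arc runs from `j` to `i + #C`, the next occurrence of the vertex `f i`.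
  have hEnd : f (i + #C) = f i := (hf.eq_iff _ _).2 (by simp [Nat.ModEq])
  have hA : insert (f i) (insert (f j) ((Ico (i + 1) j).image f)) =
      (Ico i (j + 1)).image f := by
    rw [← image_insert, ← image_insert]
    congr 1
    ext n
    simp only [mem_insert, mem_Ico]
    omega
  have hB : insert (f i) (insert (f j) ((Ico (j + 1) (i + #C)).image f)) =
      (Ico j (i + #C + 1)).image f := by
    rw [← hEnd, ← image_insert, ← image_insert]
    congr 1
    ext n
    simp only [mem_insert, mem_Ico]
    omega
  have hnot : ∀ (n p q : ℕ), i ≤ n → n < i + #C → i ≤ p → q ≤ i + #C → (n < p ∨ q ≤ n) →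
      f n ∉ (Ico p q).image f := by
    intro n p q h1 h2 h3 h4 h5 hc
    obtain ⟨m, hm, hmn⟩ := mem_image.1 hc
    rw [mem_Ico] at hm
    have := hinj (by simp; omega) (by simp; omega) hmn
    omega
  refine ⟨(Ico (i + 1) j).image f, (Ico (j + 1) (i + #C)).image f, ?_, ?_, ?_, ?_, ?_, ?_,
    hf.treeLike (by omega), hf.treeLike (by omega), ?_, ?_⟩
  · rw [disjoint_left]
    intro x hx
    obtain ⟨m, hm, rfl⟩ := mem_image.1 hx
    rw [mem_Ico] at hm
    exact hnot _ _ _ (by omega) (by omega) (by omega) (by omega) (by omega)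
  · exact hnot _ _ _ (by omega) (by omega) (by omega) (by omega) (by omega)
  · exact hnot _ _ _ (by omega) (by omega) (by omega) (by omega) (by omega)
  · exact hnot _ _ _ (by omega) (by omega) (by omega) (by omega) (by omega)
  · exact hnot _ _ _ (by omega) (by omega) (by omega) (by omega) (by omega)
  · rw [← image_union, ← image_insert, ← image_insert]
    conv_rhs => rw [← hf.image_Ico (by omega) i]
    congr 1
    ext n
    simp only [mem_insert, mem_union, mem_Ico]
    omega
  · rw [hA]; exact hf.treeLike (by omega)
  · rw [hB]; exact hf.treeLike (by omega)

/-- Averaging over the independent sets of every other vertex along a long induced cycle. -/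
lemma MinCyclic.mul_card_le {C : Finset V} (h : MinCyclic G C) {t c : ℕ} (ht : 2 * t ≤ #C)
    (g : V → ℕ) (hX : ∀ X ⊆ C, Indep G X → #X = t → c ≤ ∑ x ∈ X, g x) :
    #C * c ≤ t * ∑ x ∈ C, g x := by
  obtain ⟨f, hf⟩ := h.exists_isCyclicOrder
  have h3 := h.three_le_card
  -- The cycle is induced: a neighbour other than the two consecutive vertices would raise the
  -- degree to three.
  have hsucc : ∀ i, ∀ w ∈ C, G.Adj (f (i + 1)) w → w = f i ∨ w = f (i + 2) := by
    intro i w hw hadj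
    by_contra! hc
    have hne : f i ≠ f (i + 2) := by
      intro he
      have := hf.injOn (p := i) (q := i + #C) le_rfl (by simp only [coe_Ico, Set.mem_Ico]; omega)
        (by simp only [coe_Ico, Set.mem_Ico]; omega) he
      omega
    have h4 : 3 ≤ dIn G C (f (i + 1)) := by
      have hsub : ({f i, f (i + 2), w} : Finset V) ⊆ {u ∈ C | G.Adj (f (i + 1)) u} := by
        intro u hu
        simp only [mem_insert, mem_singleton] at hu
        rw [mem_filter]
        rcases hu with rfl | rfl | rfl
        · exact ⟨hf.mem (by omega) _, (hf.adj i).symm⟩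
        · exact ⟨hf.mem (by omega) _, hf.adj (i + 1)⟩
        · exact ⟨hw, hadj⟩
      have := card_le_card hsub
      rw [card_eq_three.2 ⟨_, _, _, hne, hc.1.symm, hc.2.symm, rfl⟩] at this
      exact this
    have := h.dIn_eq _ (hf.mem (by omega) (i + 1))
    omega
  have hrot : ∀ i, ∑ r ∈ range #C, g (f (r + i)) = ∑ x ∈ C, g x := by
    intro i
    have h1 : ∑ x ∈ C, g x = ∑ n ∈ Ico i (i + #C), g (f n) := by
      conv_lhs => rw [← hf.image_Ico (by omega) i]
      exact sum_image (hf.injOn le_rfl)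
    rw [h1, sum_Ico_eq_sum_range]
    simp [add_comm]
  -- Take `t` vertices at even distances from `r`. Because `2 * t ≤ #C`, the last one is not
  -- adjacent to the first across the end of the period.
  have hr : ∀ r ∈ range #C, c ≤ ∑ i ∈ range t, g (f (r + 2 * i)) := by
    intro r _
    have hinj : Set.InjOn (fun i => f (r + 2 * i)) (range t : Finset ℕ) := by
      intro i hi j hj hij
      simp only [coe_range, Set.mem_Iio] at hi hj
      have := hf.injOn (p := r) (q := r + #C) le_rfl (by simp; omega) (by simp; omega) hij
      omega
    have := hX ((range t).image (fun i => f (r + 2 * i))) ?_ ?_ ?_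
    · rwa [sum_image hinj] at this
    · intro x hx
      obtain ⟨i, -, rfl⟩ := mem_image.1 hx
      exact hf.mem (by omega) _
    · intro x hx y hy
      obtain ⟨i, hi, rfl⟩ := mem_image.1 hx
      obtain ⟨j, hj, rfl⟩ := mem_image.1 hy
      rw [mem_range] at hi hj
      have key : ∀ i j, i < t → j < t → i ≤ j → ¬ G.Adj (f (r + 2 * i)) (f (r + 2 * j)) := by
        intro i j hi hj hij hadj
        rcases hij.eq_or_lt with rfl | hlt
        · exact G.loopless.irrefl _ hadj
        obtain ⟨j', rfl⟩ : ∃ j', j = j' + 1 := ⟨j - 1, by omega⟩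
        have e1 : r + 2 * (j' + 1) = r + 2 * j' + 1 + 1 := by ring
        rw [e1] at hadj
        rcases hsucc _ _ (hf.mem (by omega) _) hadj.symm with he | he
        · have := hf.injOn (p := r) (q := r + #C) le_rfl (by simp; omega) (by simp; omega) he
          omega
        · have := hf.injOn (p := r + 2 * i) (q := r + 2 * i + #C) le_rfl
            (by simp only [coe_Ico, Set.mem_Ico]; omega)
            (by simp only [coe_Ico, Set.mem_Ico]; omega) he
          omega
      rcases le_total i j with hij | hij
      · exact key i j hi hj hij
      · exact fun hc => key j i hj hi hij hc.symm
    · rw [card_image_of_injOn hinj, card_range]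
  -- Letting `r` run over a whole period counts every vertex `t` times.
  calc #C * c = ∑ r ∈ range #C, c := by simp
    _ ≤ ∑ r ∈ range #C, ∑ i ∈ range t, g (f (r + 2 * i)) := sum_le_sum hr
    _ = ∑ i ∈ range t, ∑ r ∈ range #C, g (f (r + 2 * i)) := sum_comm
    _ = t * ∑ x ∈ C, g x := by simp [hrot]

end

/-! ### Disjoint subtrees of a forest through marked vertices -/

section

variable {V : Type*} {G : SimpleGraph V} {S T A B X : Finset V} {v w x : V}

/-- The number of vertices of degree one in `S` plus twice the number of isolated ones. -/
noncomputable def leafWeight (G : SimpleGraph V) (S : Finset V) : ℕ := ∑ v ∈ S, (2 - dIn G S v)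

/-- Deleting `v` removes its own deficit `2 - d` and raises the deficit of each of its `d`
neighbours by at most one. -/
lemma leafWeight_erase_add_two_le (hv : v ∈ S) (hd : dIn G S v ≤ 1) :
    leafWeight G (S.erase v) + 2 ≤ leafWeight G S + 2 * dIn G S v := by
  have h1 : leafWeight G (S.erase v) ≤
      ∑ w ∈ S.erase v, ((2 - dIn G S w) + if G.Adj v w then 1 else 0) := by
    refine sum_le_sum fun w _ => ?_
    have h2 := dIn_erase_add (G := G) hv w
    rw [G.adj_comm] at h2
    omega
  rw [sum_add_distrib, ← dIn_eq_sum, dIn_erase_self] at h1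
  have h2 : leafWeight G S = ∑ w ∈ S.erase v, (2 - dIn G S w) + (2 - dIn G S v) :=
    (sum_erase_add S _ hv).symm
  omega

lemma treeLike_pair (h : G.Adj v w) :
    2 * #({v, w} : Finset V) ≤ edgePairs G {v, w} {v, w} + 2 := by
  have hne : v ∉ ({w} : Finset V) := by simpa using G.ne_of_adj h
  rw [edgePairs_insert_self hne, card_insert_of_notMem hne, dIn_singleton, if_pos h]
  simp

/-- An acyclic set with many marked vertices contains two disjoint subtrees with two marked
vertices each. -/
lemma exists_two_treeLike {D : Finset V} (h : ¬ Cyclic G S) (hDS : D ⊆ S)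
    (hD : leafWeight G S + 2 ≤ #D) :
    ∃ Z Z' : Finset V, Z ⊆ S ∧ Z' ⊆ S ∧ Disjoint Z Z' ∧
      2 * #Z ≤ edgePairs G Z Z + 2 ∧ 2 * #Z' ≤ edgePairs G Z' Z' + 2 ∧
      2 ≤ #(Z ∩ D) ∧ 2 ≤ #(Z' ∩ D) := by
  induction S using Finset.strongInduction generalizing D with
  | H S ih =>
    have hne : S.Nonempty := by
      have : 0 < #D := by omega
      exact (card_pos.1 this).mono hDS
    have hacy : ∀ v, ¬ Cyclic G (S.erase v) := fun v hc => h (hc.mono (erase_subset _ _))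
    -- a leaf outside `D` can be deleted
    have hdel : ∀ v ∈ S, dIn G S v ≤ 1 → (v ∈ D → dIn G S v = 0) →
        ∃ Z Z' : Finset V, Z ⊆ S ∧ Z' ⊆ S ∧ Disjoint Z Z' ∧
          2 * #Z ≤ edgePairs G Z Z + 2 ∧ 2 * #Z' ≤ edgePairs G Z' Z' + 2 ∧
          2 ≤ #(Z ∩ D) ∧ 2 ≤ #(Z' ∩ D) := by
      intro v hv hd hvD
      have hw := leafWeight_erase_add_two_le hv hd
      -- A marked `v` is isolated here: one mark is lost, but the weight drops by two. An unmarked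
      -- leaf costs no mark and does not raise the weight.
      have hcard : leafWeight G (S.erase v) + 2 ≤ #(D.erase v) := by
        by_cases hmem : v ∈ D
        · have := card_erase_add_one hmem
          have := hvD hmem
          omega
        · rw [erase_eq_of_notMem hmem]; omega
      obtain ⟨Z, Z', h1, h2, h3, h4, h5, h6, h7⟩ :=
        ih _ (erase_ssubset hv) (hacy v) (erase_subset_erase v hDS) hcard
      exact ⟨Z, Z', h1.trans (erase_subset _ _), h2.trans (erase_subset _ _), h3, h4, h5,
        h6.trans (card_le_card (inter_subset_inter_left (erase_subset _ _))),
        h7.trans (card_le_card (inter_subset_inter_left (erase_subset _ _)))⟩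
    by_cases hred : ∃ v ∈ S, dIn G S v ≤ 1 ∧ (v ∈ D → dIn G S v = 0)
    · obtain ⟨v, hv, hd, hvD⟩ := hred
      exact hdel v hv hd hvD
    push Not at hred
    have hleafD : ∀ v ∈ S, dIn G S v ≤ 1 → v ∈ D ∧ dIn G S v = 1 := fun v hv hd =>
      ⟨(hred v hv hd).1, by have := (hred v hv hd).2; omega⟩
    have huniq : ∀ v, dIn G S v ≤ 1 → ∀ a ∈ S, ∀ b ∈ S, G.Adj v a → G.Adj v b → a = b := by
      intro v hd a ha b hb hva hvb
      by_contra hab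
      have := two_le_dIn_iff.2 ⟨a, ha, b, hb, hab, hva, hvb⟩
      omega
    by_cases hmove : ∃ v ∈ S, dIn G S v ≤ 1 ∧ ∃ u ∈ S, G.Adj v u ∧ u ∉ D
    · -- a leaf in `D` whose neighbour is not in `D`: move the mark
      obtain ⟨v, hv, hd, u, hu, hvu, huD⟩ := hmove
      have hvD := (hleafD v hv hd).1
      have huv : u ≠ v := fun hc => G.ne_of_adj hvu hc.symm
      have hw := leafWeight_erase_add_two_le hv hd
      have hcard : #(insert u (D.erase v)) = #D := by
        rw [card_insert_of_notMem (by simp [huD]), card_erase_add_one hvD]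
      have hsub : insert u (D.erase v) ⊆ S.erase v := by
        rw [insert_subset_iff]
        exact ⟨mem_erase.2 ⟨huv, hu⟩, erase_subset_erase v hDS⟩
      obtain ⟨Z, Z', h1, h2, h3, h4, h5, h6, h7⟩ :=
        ih _ (erase_ssubset hv) (hacy v) hsub (by omega)
      have hvZ : ∀ {Z}, Z ⊆ S.erase v → v ∉ Z := fun hZ hc => (mem_erase.1 (hZ hc)).1 rfl
      -- A subtree that uses the moved mark at `u` is extended by the edge back to `v`, which
      -- carries the original mark.
      have grow : ∀ Z ⊆ S.erase v, 2 * #Z ≤ edgePairs G Z Z + 2 →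
          2 ≤ #(Z ∩ insert u (D.erase v)) →
          2 * #(if u ∈ Z then insert v Z else Z) ≤
            edgePairs G (if u ∈ Z then insert v Z else Z) (if u ∈ Z then insert v Z else Z) + 2 ∧
          2 ≤ #((if u ∈ Z then insert v Z else Z) ∩ D) := by
        intro Z hZ hT hc
        have hv' := hvZ hZ
        split_ifs with huZ
        · constructor
          · rw [card_insert_of_notMem hv', edgePairs_insert_self hv']
            have : 0 < dIn G Z v := dIn_pos_iff.2 ⟨u, huZ, hvu⟩
            omega
          · refine hc.trans ?_
            rw [inter_insert_of_mem huZ, insert_inter_of_mem hvD,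
              card_insert_of_notMem (show v ∉ Z ∩ D by simp [hv'])]
            refine (card_insert_le _ _).trans ?_
            gcongr
            exact erase_subset _ _
        · refine ⟨hT, hc.trans ?_⟩
          rw [inter_insert_of_notMem huZ]
          exact card_le_card (inter_subset_inter_left (erase_subset _ _))
      have hsubS : ∀ Z ⊆ S.erase v, (if u ∈ Z then insert v Z else Z) ⊆ S := by
        intro Z hZ
        split_ifs
        · exact insert_subset hv (hZ.trans (erase_subset _ _))
        · exact hZ.trans (erase_subset _ _)
      refine ⟨if u ∈ Z then insert v Z else Z, if u ∈ Z' then insert v Z' else Z',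
        hsubS Z h1, hsubS Z' h2, ?_, (grow Z h1 h4 h6).1, (grow Z' h2 h5 h7).1,
        (grow Z h1 h4 h6).2, (grow Z' h2 h5 h7).2⟩
      have hv1 := hvZ h1
      have hv2 := hvZ h2
      split_ifs with hz hz'
      · exact absurd hz' (disjoint_left.1 h3 hz)
      · simp [h3, hv2]
      · simp [h3, hv1]
      · exact h3
    · push Not at hmove
      obtain ⟨v, hv, hd⟩ := exists_dIn_le_one h subset_rfl hne
      obtain ⟨hvD, hd1⟩ := hleafD v hv hd
      obtain ⟨u, hu, hvu⟩ := dIn_pos_iff.1 (show 0 < dIn G S v by omega)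
      have huD := hmove v hv hd u hu hvu
      have huv : u ≠ v := fun hc => G.ne_of_adj hvu hc.symm
      -- All leaves and their neighbours are now marked, so two leaf edges with different inner ends
      -- would be the required subtrees.
      by_cases hother : ∃ w ∈ S, dIn G S w ≤ 1 ∧ w ≠ u ∧ ¬ G.Adj w u
      · obtain ⟨w, hw, hdw, hwu, hnadj⟩ := hother
        obtain ⟨hwD, hdw1⟩ := hleafD w hw hdw
        obtain ⟨x, hx, hwx⟩ := dIn_pos_iff.1 (show 0 < dIn G S w by omega)
        have hxD := hmove w hw hdw x hx hwx
        have hxu : x ≠ u := fun hc => hnadj (hc ▸ hwx)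
        have hwv : w ≠ v := fun hc => hnadj (hc ▸ hvu)
        have hxv : x ≠ v := fun hc => hwu (huniq v hd w hw u hu (hc ▸ hwx.symm) hvu)
        refine ⟨{v, u}, {w, x}, ?_, ?_, ?_, treeLike_pair hvu, treeLike_pair hwx, ?_, ?_⟩
        · simp [insert_subset_iff, hv, hu]
        · simp [insert_subset_iff, hw, hx]
        · simp [hwv, hwu, hxv, hxu]
        · rw [inter_eq_left.2 (by simp [insert_subset_iff, hvD, huD]), card_pair huv.symm]
        · rw [inter_eq_left.2 (by simp [insert_subset_iff, hwD, hxD]),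
            card_pair (G.ne_of_adj hwx)]
      · exfalso
        push Not at hother
        -- All leaves other than `u` hang on `u`. If `R` is empty, then `Λ ≥ |S| - 1`, too much for
        -- the number of marks. Otherwise the forest bound on `R ∪ {u}` leaves no edge from `u` to
        -- `R`, so `R` itself has minimum degree two.
        set R := {w ∈ S | w ≠ u ∧ 2 ≤ dIn G S w} with hR
        have huR : u ∉ R := by simp [hR]
        have hRS : R ⊆ S := filter_subset _ _
        have hnb : ∀ w ∈ R, dIn G (insert u R) w = dIn G S w := by
          intro w hw
          rw [hR, mem_filter] at hw
          apply le_antisymm (dIn_mono (insert_subset hu hRS) w)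
          apply card_le_card
          intro y hy
          rw [mem_filter] at hy ⊢
          refine ⟨?_, hy.2⟩
          by_cases hyu : y = u
          · simp [hyu]
          · rw [mem_insert, hR, mem_filter]
            refine Or.inr ⟨hy.1, hyu, ?_⟩
            by_contra! hlt
            have := hother y hy.1 (by omega) hyu
            exact hw.2.1 (huniq y (by omega) w hw.1 u hu hy.2.symm this)
        have h1 := edgePairs_add_two_le (G := G) (S := insert u R)
          (fun hc => h (hc.mono (insert_subset hu hRS))) (insert_nonempty _ _)
        have h2 : ∑ w ∈ R, 2 ≤ ∑ w ∈ R, dIn G (insert u R) w :=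
          sum_le_sum fun w hw => by
            rw [hnb w hw]
            rw [hR, mem_filter] at hw
            exact hw.2.2
        have h3 : edgePairs G (insert u R) (insert u R) =
            dIn G (insert u R) u + ∑ w ∈ R, dIn G (insert u R) w := sum_insert huR
        have h4 : dIn G (insert u R) u = dIn G R u := by
          rw [dIn_insert huR]; simp
        rw [card_insert_of_notMem huR] at h1
        simp only [sum_const, smul_eq_mul] at h2
        have h5 : dIn G R u = 0 := by omega
        rw [dIn_eq_zero_iff] at h5
        rcases R.eq_empty_or_nonempty with h0 | h0
        · have h6 : ∑ w ∈ S.erase u, 1 ≤ ∑ w ∈ S.erase u, (2 - dIn G S w) := by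
            refine sum_le_sum fun w hw => ?_
            rw [mem_erase] at hw
            by_contra! hc
            have : w ∈ R := by
              rw [hR, mem_filter]; exact ⟨hw.2, hw.1, by omega⟩
            rw [h0] at this
            simp at this
          have h7 : leafWeight G S = ∑ w ∈ S.erase u, (2 - dIn G S w) + (2 - dIn G S u) :=
            (sum_erase_add S _ hu).symm
          have h8 := card_erase_add_one hu
          have h9 := card_le_card hDS
          simp only [sum_const, smul_eq_mul, mul_one] at h6
          omega
        · refine h ⟨R, hRS, h0, fun w hw => ?_⟩
          have h6 := hnb w hw
          rw [dIn_insert huR, if_neg (fun hc => h5 w hw hc.symm)] at h6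
          rw [hR, mem_filter] at hw
          omega

end

/-! ### Packings and optimal packings -/

section

variable {V : Type*} {G : SimpleGraph V} {A B X Z Z' : Finset V} {v w x : V} {j : ℕ}

/-- A family of pairwise disjoint cyclic sets. -/
structure IsPacking (G : SimpleGraph V) (S : Fin j → Finset V) : Prop where
  cyclic : ∀ i, Cyclic G (S i)
  disj : ∀ i i', i ≠ i' → Disjoint (S i) (S i')

lemma IsPacking.hasDisjointCycles {S : Fin j → Finset V} (h : IsPacking G S) :
    HasDisjointCycles G j := by
  choose v c hc hs using fun i => (h.cyclic i).exists_isCycle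
  refine ⟨v, c, hc, fun i i' hne w hw hw' => ?_⟩
  exact disjoint_left.1 (h.disj i i' hne) (hs i w hw) (hs i' w hw')

lemma IsPacking.update {S : Fin j → Finset V} (h : IsPacking G S) (i : Fin j)
    (hZ : Cyclic G Z) (hd : ∀ l, l ≠ i → Disjoint Z (S l)) :
    IsPacking G (Function.update S i Z) := by
  constructor
  · intro l
    by_cases hl : l = i
    · subst hl; simpa using hZ
    · simpa [hl] using h.cyclic l
  · intro l l' hne
    by_cases hl : l = i
    · subst hl
      simpa [hne.symm] using hd l' hne.symm
    · by_cases hl' : l' = i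
      · subst hl'
        simpa [hl] using (hd l hl).symm
      · simpa [hl, hl'] using h.disj l l' hne

lemma IsPacking.cons {S : Fin j → Finset V} (h : IsPacking G S)
    (hZ : Cyclic G Z) (hd : ∀ l, Disjoint Z (S l)) :
    IsPacking G (Fin.cons Z S : Fin (j + 1) → Finset V) := by
  constructor
  · intro l
    refine Fin.cases ?_ (fun l => ?_) l
    · simpa using hZ
    · simpa using h.cyclic l
  · intro l l'
    refine Fin.cases ?_ (fun l => ?_) l <;> refine Fin.cases ?_ (fun l' => ?_) l'
    · simp
    · intro _; simpa using hd l'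
    · intro _; simpa using (hd l).symm
    · intro hne
      simpa using h.disj l l' (fun hc => hne (by rw [hc]))

lemma sum_card_update (S : Fin j → Finset V) (i : Fin j) (Z : Finset V) :
    ∑ l, #(Function.update S i Z l) + #(S i) = ∑ l, #(S l) + #Z := by
  have h1 : ∀ l, #(Function.update S i Z l) = Function.update (fun l => #(S l)) i #Z l := by
    intro l
    by_cases hl : l = i
    · subst hl; simp
    · simp [hl]
  simp only [h1]
  rw [sum_update_of_mem (mem_univ i), ← sum_sdiff (subset_univ {i}) (f := fun l => #(S l))]
  simp
  ring

variable [Fintype V]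

/-- The vertices outside a family of sets. -/
noncomputable def rest (S : Fin j → Finset V) : Finset V := (univ.biUnion S)ᶜ

lemma mem_rest {S : Fin j → Finset V} : v ∈ rest S ↔ ∀ i, v ∉ S i := by
  simp [rest]

/-- A packing of minimum total size whose complement spans as many edges as possible, in a graph
without larger packings. -/
structure IsOptimal (G : SimpleGraph V) (S : Fin j → Finset V) : Prop extends IsPacking G S where
  not_succ : ∀ S' : Fin (j + 1) → Finset V, ¬ IsPacking G S'
  sum_le : ∀ S' : Fin j → Finset V, IsPacking G S' → ∑ i, #(S i) ≤ ∑ i, #(S' i)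
  le_of_sum_eq : ∀ S' : Fin j → Finset V, IsPacking G S' → ∑ i, #(S' i) = ∑ i, #(S i) →
    edgePairs G (rest S') (rest S') ≤ edgePairs G (rest S) (rest S)

lemma exists_isOptimal {S : Fin j → Finset V} (h : IsPacking G S)
    (hno : ∀ S' : Fin (j + 1) → Finset V, ¬ IsPacking G S') :
    ∃ S : Fin j → Finset V, IsOptimal G S := by
  obtain ⟨S₁, h₁, hmin⟩ := Set.exists_min_image {S : Fin j → Finset V | IsPacking G S}
    (fun S => ∑ i, #(S i)) (Set.toFinite _) ⟨S, h⟩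
  obtain ⟨S₂, h₂, hmax⟩ := Set.exists_max_image
    {S : Fin j → Finset V | IsPacking G S ∧ ∑ i, #(S i) = ∑ i, #(S₁ i)}
    (fun S => edgePairs G (rest S) (rest S)) (Set.toFinite _) ⟨S₁, h₁, rfl⟩
  refine ⟨S₂, h₂.1, hno, fun S' hS' => ?_, fun S' hS' he => hmax S' ⟨hS', he.trans h₂.2⟩⟩
  rw [h₂.2]
  exact hmin S' hS'

namespace IsOptimal

variable {S : Fin j → Finset V}

lemma card_le (h : IsOptimal G S) (i : Fin j) (hZ : Cyclic G Z)
    (hd : ∀ l, l ≠ i → Disjoint Z (S l)) : #(S i) ≤ #Z := by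
  have h1 := h.sum_le _ (h.toIsPacking.update i hZ hd)
  have h2 := sum_card_update S i Z
  omega

lemma disjoint_rest (S : Fin j → Finset V) (i : Fin j) : Disjoint (S i) (rest S) :=
  disjoint_left.2 fun _ hx hr => mem_rest.1 hr i hx

lemma disjoint_of_subset (h : IsOptimal G S) {i l : Fin j} (hl : l ≠ i)
    (hZ : Z ⊆ S i ∪ rest S) : Disjoint Z (S l) := by
  refine Disjoint.mono_left hZ (disjoint_union_left.2 ⟨h.disj i l hl.symm, ?_⟩)
  exact (disjoint_rest S l).symm

lemma card_le_of_subset (h : IsOptimal G S) (i : Fin j) (hZ : Cyclic G Z)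
    (hd : Z ⊆ S i ∪ rest S) : #(S i) ≤ #Z :=
  h.card_le i hZ fun _ hl => h.disjoint_of_subset hl hd

/-- Minimum total size makes every member of the packing an induced cycle. -/
lemma minCyclic (h : IsOptimal G S) (i : Fin j) : MinCyclic G (S i) :=
  ⟨h.cyclic i, fun _ hT hc => eq_of_subset_of_card_le hT
    (h.card_le_of_subset i hc (hT.trans subset_union_left))⟩

lemma card_add_card_le (h : IsOptimal G S) {i i' : Fin j} (hne : i ≠ i') (hZ : Cyclic G Z)
    (hZ' : Cyclic G Z') (hd : Disjoint Z Z') (hs : Z ⊆ S i ∪ S i') (hs' : Z' ⊆ S i ∪ S i') :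
    #(S i) + #(S i') ≤ #Z + #Z' := by
  by_contra! hlt
  have hdl : ∀ Z ⊆ S i ∪ S i', ∀ l, l ≠ i → l ≠ i' → Disjoint Z (S l) := fun Z hs l hl hl' =>
    Disjoint.mono_left hs (disjoint_union_left.2 ⟨h.disj i l hl.symm, h.disj i' l hl'.symm⟩)
  have hcyc : ∀ l, Cyclic G (Function.update (Function.update S i Z) i' Z' l) := by
    intro l
    by_cases h1 : l = i'
    · subst h1; simpa using hZ'
    · by_cases h2 : l = i
      · subst h2; simpa [h1] using hZ
      · simpa [h1, h2] using h.cyclic l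
  have hdis : ∀ l l', l ≠ l' →
      Disjoint (Function.update (Function.update S i Z) i' Z' l)
        (Function.update (Function.update S i Z) i' Z' l') := by
    intro l l' hll
    by_cases h1 : l = i'
    · subst h1
      by_cases h2 : l' = i
      · subst h2; simpa [hne] using hd.symm
      · simpa [hll.symm, h2] using hdl Z' hs' l' h2 hll.symm
    · by_cases h1' : l' = i'
      · subst h1'
        by_cases h2 : l = i
        · subst h2; simpa [hne] using hd
        · simpa [hll, h2] using (hdl Z' hs' l h2 hll).symm
      · by_cases h2 : l = i
        · subst h2
          simpa [h1, h1', hll.symm] using hdl Z hs l' hll.symm h1'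
        · by_cases h2' : l' = i
          · subst h2'
            simpa [h1, h1', hll] using (hdl Z hs l hll h1).symm
          · simpa [h1, h1', h2, h2'] using h.disj l l' hll
  have h1 := h.sum_le _ ⟨hcyc, hdis⟩
  have h2 := sum_card_update (Function.update S i Z) i' Z'
  have h3 := sum_card_update S i Z
  rw [Function.update_of_ne hne.symm] at h2
  omega

lemma not_cyclic_rest (h : IsOptimal G S) : ¬ Cyclic G (rest S) := fun hc =>
  h.not_succ _ (h.toIsPacking.cons hc fun l => (disjoint_rest S l).symm)

lemma not_two_cyclic (h : IsOptimal G S) (i : Fin j) (hZ : Cyclic G Z) (hZ' : Cyclic G Z')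
    (hd : Disjoint Z Z') (hs : Z ⊆ S i ∪ rest S) (hs' : Z' ⊆ S i ∪ rest S) : False := by
  refine h.not_succ _ ((h.toIsPacking.update i hZ
    fun l hl => h.disjoint_of_subset hl hs).cons hZ' fun l => ?_)
  by_cases hl : l = i
  · subst hl; simpa using hd.symm
  · simpa [hl] using h.disjoint_of_subset hl hs'

/-- Exchanging a vertex of a cycle with a vertex outside the packing does not increase the number
of edges outside the packing. -/
lemma dIn_le_of_swap (h : IsOptimal G S) (i : Fin j) (hx : x ∈ rest S) (hv : v ∈ S i)
    (hd : 2 ≤ dIn G ((S i).erase v) x) : dIn G ((rest S).erase x) v ≤ dIn G (rest S) x := by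
  have hxS : ∀ l, x ∉ S l := mem_rest.1 hx
  have hxE : x ∉ (S i).erase v := fun hc => hxS i (mem_of_mem_erase hc)
  have hC := h.minCyclic i
  have h3 := hC.three_le_card
  have hcard : #(insert x ((S i).erase v)) = #(S i) := by
    rw [card_insert_of_notMem hxE, card_erase_add_one hv]
  have hcyc : Cyclic G (insert x ((S i).erase v)) := by
    apply cyclic_of_edgePairs (insert_nonempty _ _)
    rw [edgePairs_insert_self hxE, hcard]
    have := hC.edgePairs_erase hv
    omega
  have hsub : insert x ((S i).erase v) ⊆ S i ∪ rest S :=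
    insert_subset (mem_union_right _ hx) ((erase_subset _ _).trans subset_union_left)
  have hp := h.toIsPacking.update i hcyc fun l hl => h.disjoint_of_subset hl hsub
  have hsum := sum_card_update S i (insert x ((S i).erase v))
  have h1 := h.le_of_sum_eq _ hp (by omega)
  have hrest : rest (Function.update S i (insert x ((S i).erase v))) =
      insert v ((rest S).erase x) := by
    ext w
    rw [mem_rest, mem_insert, mem_erase, mem_rest]
    constructor
    · intro hw
      by_cases hwv : w = v
      · exact Or.inl hwv
      · have h4 := hw i
        rw [Function.update_self, mem_insert, mem_erase] at h4
        refine Or.inr ⟨fun hc => h4 (Or.inl hc), fun l hl => ?_⟩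
        by_cases hli : l = i
        · subst hli; exact h4 (Or.inr ⟨hwv, hl⟩)
        · have := hw l
          rw [Function.update_of_ne hli] at this
          exact this hl
    · intro hw l
      by_cases hli : l = i
      · subst hli
        rw [Function.update_self, mem_insert, mem_erase]
        rcases hw with rfl | ⟨hwx, hwS⟩
        · rintro (rfl | ⟨h5, -⟩)
          · exact hxS l hv
          · exact h5 rfl
        · rintro (rfl | ⟨-, h5⟩)
          · exact hwx rfl
          · exact hwS l h5
      · rw [Function.update_of_ne hli]
        rcases hw with rfl | ⟨-, hwS⟩
        · exact disjoint_left.1 (h.disj i l (fun hc => hli hc.symm)) hv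
        · exact hwS l
  have hvr : v ∉ (rest S).erase x := fun hc => mem_rest.1 (mem_of_mem_erase hc) i hv
  rw [hrest, edgePairs_insert_self hvr] at h1
  have h2 := edgePairs_erase_self (G := G) hx
  omega

lemma dIn_univ (h : IsOptimal G S) (v : V) :
    dIn G univ v = dIn G (rest S) v + ∑ i, dIn G (S i) v := by
  have h1 : (univ : Finset V) = rest S ∪ univ.biUnion S := by
    rw [rest, union_comm, union_compl]
  rw [h1, dIn_union (by rw [rest]; exact disjoint_compl_left), add_right_inj]
  simp only [dIn_eq_sum]
  exact sum_biUnion fun i _ i' _ hne => h.disj i i' hne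

lemma card_univ_eq (h : IsOptimal G S) : Fintype.card V = #(rest S) + ∑ i, #(S i) := by
  rw [rest, card_compl, card_biUnion fun i _ i' _ hne => h.disj i i' hne]
  have : ∑ i, #(S i) ≤ Fintype.card V := by
    rw [← card_biUnion fun i _ i' _ hne => h.disj i i' hne]
    exact card_le_univ _
  omega

end IsOptimal

end

/-! ### Edges at the cycles of an optimal packing, and the size of the complement -/

section

variable {V : Type*} {G : SimpleGraph V} {A B X Z Z' : Finset V} {v w x y z a b : V} {j : ℕ}
variable [Fintype V]

namespace IsOptimal

variable {S : Fin j → Finset V} {i i' : Fin j}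

/-- Two neighbours of `x` split the cycle into open arcs `A` and `B`. Together with `x`, either
closed arc contains a cycle, so minimality forces `|A|, |B| ≤ 1` and the cycle has at most four
vertices. -/
lemma dIn_le_one (h : IsOptimal G S) (hx : x ∈ rest S) (hL : 5 ≤ #(S i)) :
    dIn G (S i) x ≤ 1 := by
  by_contra! hc
  obtain ⟨y, hy, z, hz, hyz, hxy, hxz⟩ := two_le_dIn_iff.1 hc
  obtain ⟨A, B, hAB, hyA, hyB, hzA, hzB, hU, -, -, hA, hB⟩ := (h.minCyclic i).exists_arcs hy hz hyz
  have hxS := mem_rest.1 hx i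
  have key : ∀ A : Finset V, y ∉ A → z ∉ A → A ⊆ S i →
      2 * #(insert y (insert z A)) ≤
        edgePairs G (insert y (insert z A)) (insert y (insert z A)) + 2 → #(S i) ≤ #A + 3 := by
    intro A hyA hzA hAS hA
    have hsub : insert y (insert z A) ⊆ S i := insert_subset hy (insert_subset hz hAS)
    have hxn : x ∉ insert y (insert z A) := fun hc => hxS (hsub hc)
    have hcyc := cyclic_insert hA hxn
      (two_le_dIn_iff.2 ⟨y, by simp, z, by simp, hyz, hxy, hxz⟩)
    have := h.card_le_of_subset i hcyc
      (insert_subset (mem_union_right _ hx) (hsub.trans subset_union_left))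
    rwa [card_insert_of_notMem hxn, card_insert_of_notMem (by simp [hyz, hyA]),
      card_insert_of_notMem hzA] at this
  have hABS : A ∪ B ⊆ S i := by
    rw [← hU]; exact (subset_insert _ _).trans (subset_insert _ _)
  have h1 := key A hyA hzA (subset_union_left.trans hABS) hA
  have h2 := key B hyB hzB (subset_union_right.trans hABS) hB
  have h3 : #(S i) = #A + #B + 2 := by
    rw [← hU, card_insert_of_notMem (by simp [hyz, hyA, hyB]),
      card_insert_of_notMem (by simp [hzA, hzB]), card_union_of_disjoint hAB]
  omega

lemma not_adj_of_adj_of_adj (h : IsOptimal G S) (hx : x ∈ rest S) (hL : 4 ≤ #(S i))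
    (hy : y ∈ S i) (hz : z ∈ S i) (hxy : G.Adj x y) (hxz : G.Adj x z) : ¬ G.Adj y z := by
  intro hyz
  have hxn : x ∉ ({y, z} : Finset V) := by
    simp [G.ne_of_adj hxy, G.ne_of_adj hxz]
  have hcyc := cyclic_insert (treeLike_pair hyz) hxn
    (two_le_dIn_iff.2 ⟨y, by simp, z, by simp, G.ne_of_adj hyz, hxy, hxz⟩)
  have := h.card_le_of_subset i hcyc (insert_subset (mem_union_right _ hx)
    (insert_subset (mem_union_left _ hy) (singleton_subset_iff.2 (mem_union_left _ hz))))
  have h2 := card_le_three (a := x) (b := y) (c := z)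
  omega

/-- Only length four remains. The neighbours of `x` are independent by `not_adj_of_adj_of_adj`;
three of them would leave one vertex to supply both cycle neighbours of each. -/
lemma dIn_le_two (h : IsOptimal G S) (hx : x ∈ rest S) (hL : 4 ≤ #(S i)) :
    dIn G (S i) x ≤ 2 := by
  rcases hL.lt_or_eq with hL | hL
  · exact (h.dIn_le_one hx hL).trans (by norm_num)
  by_contra! hc
  set N := {y ∈ S i | G.Adj x y} with hN
  have hNc : 3 ≤ #N := hc
  obtain ⟨y, hyN⟩ := card_pos.1 (show 0 < #N by omega)
  have hy : y ∈ S i ∧ G.Adj x y := by simpa [hN] using hyN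
  have h0 : dIn G N y = 0 := by
    rw [dIn_eq_zero_iff]
    intro z hz
    rw [hN, mem_filter] at hz
    exact h.not_adj_of_adj_of_adj hx hL.le hy.1 hz.1 hy.2 hz.2
  have h1 := (h.minCyclic i).dIn_eq y hy.1
  have hNS : N ⊆ S i := filter_subset _ _
  rw [← union_sdiff_of_subset hNS, dIn_union disjoint_sdiff, h0] at h1
  have h2 := dIn_le_card (G := G) (S i \ N) y
  have h3 := card_sdiff_add_card_eq_card hNS
  omega

/-- If a vertex of one cycle has five neighbours on another one, then the other vertices of that
cycle have at most one neighbour there. -/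
lemma dIn_le_one_of_five_le (h : IsOptimal G S) (hne : i ≠ i') (ha : a ∈ S i') (hb : b ∈ S i')
    (hab : a ≠ b) (h5 : 5 ≤ dIn G (S i) a) : dIn G (S i) b ≤ 1 := by
  by_contra! hc
  obtain ⟨y, hy, z, hz, hyz, hby, hbz⟩ := two_le_dIn_iff.1 hc
  obtain ⟨A, B, hAB, hyA, hyB, hzA, hzB, hU, hA, hB, hA', hB'⟩ :=
    (h.minCyclic i).exists_arcs hy hz hyz
  have hABS : A ∪ B ⊆ S i := by
    rw [← hU]; exact (subset_insert _ _).trans (subset_insert _ _)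
  have hdis := disjoint_left.1 (h.disj i i' hne)
  have haS : a ∉ S i := fun hc => hdis hc ha
  have hbS : b ∉ S i := fun hc => hdis hc hb
  have h3 : #(S i) = #A + #B + 2 := by
    rw [← hU, card_insert_of_notMem (by simp [hyz, hyA, hyB]),
      card_insert_of_notMem (by simp [hzA, hzB]), card_union_of_disjoint hAB]
  have hsum : dIn G (S i) a ≤ dIn G A a + dIn G B a + 2 := by
    rw [← hU, dIn_insert (by simp [hyz, hyA, hyB]), dIn_insert (by simp [hzA, hzB]),
      dIn_union hAB]
    split_ifs <;> omega
  have hm := (h.minCyclic i').three_le_card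
  -- At least three neighbours of `a` avoid `y` and `z`, so some open arc contains two. That arc
  -- with `a`, and the other closed arc with `b`, give two disjoint cycles on at most `#(S i) + 2`
  -- vertices, fewer than before.
  have key : ∀ A B : Finset V, Disjoint A B → A ⊆ S i → B ⊆ S i → y ∉ A → y ∉ B → z ∉ A →
      z ∉ B → #(S i) = #A + #B + 2 → 2 * #A ≤ edgePairs G A A + 2 →
      2 * #(insert y (insert z B)) ≤
        edgePairs G (insert y (insert z B)) (insert y (insert z B)) + 2 → 2 ≤ dIn G A a →
      False := by
    intro A B hAB hAS hBS hyA hyB hzA hzB h3 hA hB hd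
    have hsub : insert y (insert z B) ⊆ S i := insert_subset hy (insert_subset hz hBS)
    have haA : a ∉ A := fun hc => haS (hAS hc)
    have hbB : b ∉ insert y (insert z B) := fun hc => hbS (hsub hc)
    have c1 := cyclic_insert hA haA hd
    have c2 := cyclic_insert hB hbB
      (two_le_dIn_iff.2 ⟨y, by simp, z, by simp, hyz, hby, hbz⟩)
    have hd' : Disjoint (insert a A) (insert b (insert y (insert z B))) := by
      rw [disjoint_insert_left, disjoint_insert_right]
      refine ⟨?_, fun hc => hbS (hAS hc), ?_⟩
      · rw [mem_insert, not_or]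
        exact ⟨hab, fun hc => haS (hsub hc)⟩
      · simp [hyA, hzA, hAB]
    have := h.card_add_card_le hne c1 c2 hd'
      (insert_subset (mem_union_right _ ha) (hAS.trans subset_union_left))
      (insert_subset (mem_union_right _ hb) (hsub.trans subset_union_left))
    rw [card_insert_of_notMem haA, card_insert_of_notMem hbB,
      card_insert_of_notMem (by simp [hyz, hyB]), card_insert_of_notMem hzB] at this
    omega
  have hAS := subset_union_left.trans hABS
  have hBS := subset_union_right.trans hABS
  by_cases hd : 2 ≤ dIn G A a
  · exact key A B hAB hAS hBS hyA hyB hzA hzB h3 hA hB' hd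
  · exact key B A hAB.symm hBS hAS hyB hyA hzB hzA (by omega) hB hA' (by omega)

lemma edgePairs_le_of_five_le (h : IsOptimal G S) (hne : i ≠ i') (ha : a ∈ S i')
    (h5 : 5 ≤ dIn G (S i) a) : edgePairs G (S i') (S i) + 1 ≤ #(S i) + #(S i') := by
  have h1 : edgePairs G (S i') (S i) = ∑ b ∈ (S i').erase a, dIn G (S i) b + dIn G (S i) a :=
    (sum_erase_add _ _ ha).symm
  have h2 : ∑ b ∈ (S i').erase a, dIn G (S i) b ≤ ∑ b ∈ (S i').erase a, 1 :=
    sum_le_sum fun b hb => h.dIn_le_one_of_five_le hne ha (mem_of_mem_erase hb)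
      (ne_of_mem_erase hb).symm h5
  have h3 := dIn_le_card (G := G) (S i) a
  have h4 := card_erase_add_one ha
  simp only [sum_const, smul_eq_mul, mul_one] at h2
  omega

lemma edgePairs_le_or (h : IsOptimal G S) (hne : i ≠ i') :
    edgePairs G (S i') (S i) + 1 ≤ #(S i) + #(S i') ∨ ∀ a ∈ S i', dIn G (S i) a ≤ 4 := by
  by_cases hex : ∃ a ∈ S i', 5 ≤ dIn G (S i) a
  · obtain ⟨a, ha, h5⟩ := hex
    exact Or.inl (h.edgePairs_le_of_five_le hne ha h5)
  · push Not at hex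
    exact Or.inr fun a ha => by have := hex a ha; omega

/-- Each open arc cut out by two neighbours `y`, `z` of `a` sends at most two edges to `P`, the
other cycle without `a`. With three, arc and path would span more edges than vertices, hence a cycle
missing a vertex, while `a` closes the other arc: a smaller pair. So `16 = 4 + 4 + 4 + 2 + 2`, from
`a`, `y`, `z` and the arcs. -/
lemma edgePairs_le_of_dIn_le_four (h : IsOptimal G S) (hne : i ≠ i')
    (h4 : ∀ a ∈ S i', dIn G (S i) a ≤ 4) (h4' : ∀ a ∈ S i, dIn G (S i') a ≤ 4)
    (ha : a ∈ S i') (h2 : 2 ≤ dIn G (S i) a) : edgePairs G (S i') (S i) ≤ 16 := by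
  obtain ⟨y, hy, z, hz, hyz, hay, haz⟩ := two_le_dIn_iff.1 h2
  obtain ⟨A, B, hAB, hyA, hyB, hzA, hzB, hU, hA, hB, hA', hB'⟩ :=
    (h.minCyclic i).exists_arcs hy hz hyz
  have hABS : A ∪ B ⊆ S i := by
    rw [← hU]; exact (subset_insert _ _).trans (subset_insert _ _)
  have hdis := disjoint_left.1 (h.disj i i' hne)
  have haS : a ∉ S i := fun hc => hdis hc ha
  have h3 : #(S i) = #A + #B + 2 := by
    rw [← hU, card_insert_of_notMem (by simp [hyz, hyA, hyB]),
      card_insert_of_notMem (by simp [hzA, hzB]), card_union_of_disjoint hAB]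
  set P := (S i').erase a with hP
  have hPS : P ⊆ S i' := erase_subset _ _
  have hPc : #P + 1 = #(S i') := card_erase_add_one ha
  have hPe : edgePairs G P P + 4 = 2 * #(S i') := (h.minCyclic i').edgePairs_erase ha
  have key : ∀ A B : Finset V, Disjoint A B → A ⊆ S i → B ⊆ S i → y ∉ A → y ∉ B → z ∉ A →
      z ∉ B → #(S i) = #A + #B + 2 → 2 * #A ≤ edgePairs G A A + 2 →
      2 * #(insert y (insert z B)) ≤
        edgePairs G (insert y (insert z B)) (insert y (insert z B)) + 2 →
      edgePairs G A P ≤ 2 := by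
    intro A B hAB hAS hBS hyA hyB hzA hzB h3 hA hB
    by_contra! hc
    have hsub : insert y (insert z B) ⊆ S i := insert_subset hy (insert_subset hz hBS)
    have haB : a ∉ insert y (insert z B) := fun hc => haS (hsub hc)
    have hAP : Disjoint A P := Disjoint.mono hAS hPS (h.disj i i' hne)
    obtain ⟨T, hT, hTc⟩ := exists_ssubset_cyclic (G := G) (S := A ∪ P) (by
      rw [edgePairs_union_self hAP, card_union_of_disjoint hAP]; omega)
    have hTlt := card_lt_card hT
    rw [card_union_of_disjoint hAP] at hTlt
    have c2 := cyclic_insert hB haB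
      (two_le_dIn_iff.2 ⟨y, by simp, z, by simp, hyz, hay, haz⟩)
    have hd' : Disjoint T (insert a (insert y (insert z B))) := by
      refine Disjoint.mono_left hT.subset (disjoint_union_left.2 ⟨?_, ?_⟩)
      · rw [disjoint_insert_right, disjoint_insert_right, disjoint_insert_right]
        exact ⟨fun hc => haS (hAS hc), hyA, hzA, hAB⟩
      · rw [disjoint_insert_right]
        exact ⟨by simp [hP], Disjoint.mono hPS hsub (h.disj i i' hne).symm⟩
    have := h.card_add_card_le hne hTc c2 hd'
      (hT.subset.trans (union_subset_union hAS hPS))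
      (insert_subset (mem_union_right _ ha) (hsub.trans subset_union_left))
    rw [card_insert_of_notMem haB,
      card_insert_of_notMem (by simp [hyz, hyB]), card_insert_of_notMem hzB] at this
    omega
  have hAS := subset_union_left.trans hABS
  have hBS := subset_union_right.trans hABS
  have k1 := key A B hAB hAS hBS hyA hyB hzA hzB h3 hA hB'
  have k2 := key B A hAB.symm hBS hAS hyB hyA hzB hzA (by omega) hB hA'
  have e1 : edgePairs G (S i') (S i) = edgePairs G P (S i) + dIn G (S i) a :=
    (sum_erase_add _ _ ha).symm
  have e2 : edgePairs G P (S i) =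
      dIn G P y + (dIn G P z + (edgePairs G A P + edgePairs G B P)) := by
    rw [edgePairs_comm, ← hU, ← edgePairs_union_left hAB]
    exact (sum_insert (by simp [hyz, hyA, hyB])).trans
      (congrArg _ (sum_insert (by simp [hzA, hzB])))
  have b1 := h4 a ha
  have b2 := (dIn_mono (G := G) hPS y).trans (h4' y hy)
  have b3 := (dIn_mono (G := G) hPS z).trans (h4' z hz)
  omega

lemma edgePairs_le (h : IsOptimal G S) (hne : i ≠ i') (hle : #(S i') ≤ #(S i))
    (hL : 10 ≤ #(S i)) : edgePairs G (S i') (S i) ≤ 2 * #(S i) := by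
  rcases h.edgePairs_le_or hne with h1 | h4
  · omega
  rcases h.edgePairs_le_or hne.symm with h1 | h4'
  · rw [edgePairs_comm] at h1; omega
  by_cases hex : ∃ a ∈ S i', 2 ≤ dIn G (S i) a
  · obtain ⟨a, ha, h2⟩ := hex
    have := h.edgePairs_le_of_dIn_le_four hne h4 h4' ha h2
    omega
  · push Not at hex
    have : edgePairs G (S i') (S i) ≤ ∑ a ∈ S i', 1 :=
      sum_le_sum fun a ha => by have := hex a ha; omega
    simp at this
    omega

/-- Compared with the bound `2 * #(S i)` of `edgePairs_le`, a short partner saves almost a whole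
`#(S i)`; this saving roughly doubles the lower bound on the complement. -/
lemma edgePairs_le_of_card_le_four (h : IsOptimal G S) (hne : i ≠ i') (hle : #(S i') ≤ 4)
    (hL : 10 ≤ #(S i)) : edgePairs G (S i') (S i) ≤ #(S i) + 6 := by
  rcases h.edgePairs_le_or hne with h1 | h4
  · omega
  · have : edgePairs G (S i') (S i) ≤ ∑ a ∈ S i', 4 := sum_le_sum h4
    simp at this
    omega

variable {t c : ℕ}

lemma sum_dIn_univ (h : IsOptimal G S) (X : Finset V) :
    ∑ x ∈ X, dIn G univ x = edgePairs G X (rest S) + ∑ i, edgePairs G X (S i) := by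
  simp only [h.dIn_univ, sum_add_distrib, edgePairs]
  rw [sum_comm]

lemma edgePairs_le_of_five_le_card (h : IsOptimal G S) (hX : X ⊆ rest S) (hL : 5 ≤ #(S i)) :
    edgePairs G X (S i) ≤ #X := by
  have : edgePairs G X (S i) ≤ ∑ x ∈ X, 1 := sum_le_sum fun x hx => h.dIn_le_one (hX hx) hL
  simpa using this

/-- If some cycle is long, then the complement of the packing is large. -/
lemma mul_card_le_of_long (h : IsOptimal G S) (ht : 5 ≤ t) (hc : 2 * j * t + t + 1 ≤ c)
    (hdeg : ∀ X, Indep G X → #X = t → c ≤ ∑ x ∈ X, dIn G univ x)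
    (hL : 2 * t ≤ #(S i)) :
    #(S i) * (2 * j * t + t + 1) ≤
      t * (#(rest S) + 2 * #(S i) + ∑ l ∈ univ.erase i, edgePairs G (S l) (S i)) := by
  have h1 := (h.minCyclic i).mul_card_le hL (dIn G univ)
    fun X _ hX hXt => hc.trans (hdeg X hX hXt)
  refine h1.trans (Nat.mul_le_mul_left _ ?_)
  rw [h.sum_dIn_univ, ← sum_erase_add _ _ (mem_univ i), (h.minCyclic i).edgePairs_eq,
    edgePairs_comm]
  have h2 := h.edgePairs_le_of_five_le_card (X := rest S) (i := i) subset_rfl (by omega)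
  have h3 : ∀ l, edgePairs G (S i) (S l) = edgePairs G (S l) (S i) :=
    fun l => edgePairs_comm _ _
  simp only [h3]
  omega

/-- If all cycles have at most `2t - 1` vertices, the bounds come from counting: the complement gets
one full share `2t - 1`, and a cycle with at most four vertices frees another `2t - 5`. Otherwise
the averaged degree bound is applied to a longest cycle, which receives at most `|H|` edges from the
complement. -/
lemma card_rest (h : IsOptimal G S) (ht : 5 ≤ t) (hc : 2 * j * t + t + 1 ≤ c)
    (hdeg : ∀ X, Indep G X → #X = t → c ≤ ∑ x ∈ X, dIn G univ x)
    (hn : (2 * t - 1) * (j + 1) ≤ Fintype.card V) :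
    2 * t - 1 ≤ #(rest S) ∧ ((∃ i, #(S i) ≤ 4) → 4 * t - 6 ≤ #(rest S)) := by
  by_cases hlong : ∃ i, 2 * t ≤ #(S i)
  · obtain ⟨i₀, hi₀⟩ := hlong
    obtain ⟨i, -, hmax⟩ := exists_max_image univ (fun i => #(S i)) ⟨i₀, mem_univ _⟩
    have hL : 2 * t ≤ #(S i) := hi₀.trans (hmax i₀ (mem_univ _))
    have h1 := h.mul_card_le_of_long ht hc hdeg hL
    have hle : ∀ l ∈ univ.erase i, edgePairs G (S l) (S i) ≤ 2 * #(S i) := fun l hl =>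
      h.edgePairs_le (ne_of_mem_erase hl).symm (hmax l (mem_univ _)) (by omega)
    have hj : #(univ.erase i) + 1 = j := by
      rw [card_erase_add_one (mem_univ i)]; simp
    constructor
    · have h2 := sum_le_sum hle
      rw [sum_const, smul_eq_mul] at h2
      have h3 := h1.trans (Nat.mul_le_mul_left t (Nat.add_le_add_left h2 _))
      have h4 : #(S i) * t + #(S i) ≤ t * #(rest S) := by
        have : #(S i) * (2 * j * t + t + 1) =
            #(S i) * (2 * (#(univ.erase i) + 1) * t + t + 1) := by rw [hj]
        rw [this] at h3
        nlinarith
      by_contra! hlt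
      have : t * #(rest S) ≤ t * #(S i) := Nat.mul_le_mul_left _ (by omega)
      nlinarith
    · rintro ⟨i', hi'⟩
      have hii : i' ≠ i := by
        rintro rfl
        omega
      have h5 := h.edgePairs_le_of_card_le_four (i := i) hii.symm hi' (by omega)
      have hmem : i' ∈ univ.erase i := mem_erase.2 ⟨hii, mem_univ _⟩
      rw [← sum_erase_add _ _ hmem] at h1
      have h2 := sum_le_sum fun l hl => hle l (mem_of_mem_erase (s := univ.erase i) (a := i') hl)
      rw [sum_const, smul_eq_mul] at h2
      have hj' : #((univ.erase i).erase i') + 1 + 1 = j := by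
        rw [card_erase_add_one hmem, hj]
      have h3 := h1.trans (Nat.mul_le_mul_left t (Nat.add_le_add_left (Nat.add_le_add h2 h5) _))
      have h4 : 2 * t * #(S i) + #(S i) ≤ t * (#(rest S) + 6) := by
        have : #(S i) * (2 * j * t + t + 1) =
            #(S i) * (2 * (#((univ.erase i).erase i') + 1 + 1) * t + t + 1) := by rw [hj']
        rw [this] at h3
        nlinarith
      by_contra! hlt
      have : t * (#(rest S) + 6 + 1) ≤ t * (2 * #(S i)) := Nat.mul_le_mul_left _ (by omega)
      nlinarith
  · push Not at hlong
    have h1 := h.card_univ_eq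
    constructor
    · have h2 : ∑ i, #(S i) ≤ ∑ _i : Fin j, (2 * t - 1) :=
        sum_le_sum fun i _ => by have := hlong i; omega
      simp only [sum_const, card_univ, Fintype.card_fin, smul_eq_mul] at h2
      have : (2 * t - 1) * (j + 1) = j * (2 * t - 1) + (2 * t - 1) := by ring
      omega
    · rintro ⟨i', hi'⟩
      have h2 : ∑ i ∈ univ.erase i', #(S i) ≤ ∑ _i ∈ univ.erase i', (2 * t - 1) :=
        sum_le_sum fun i _ => by have := hlong i; omega
      have hj : #(univ.erase i') + 1 = j := by
        rw [card_erase_add_one (mem_univ i')]; simp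
      rw [← sum_erase_add _ _ (mem_univ i')] at h1
      simp only [sum_const, smul_eq_mul] at h2
      have : (2 * t - 1) * (j + 1) =
          #(univ.erase i') * (2 * t - 1) + (2 * t - 1) + (2 * t - 1) := by
        have : (2 * t - 1) * (j + 1) = (2 * t - 1) * (#(univ.erase i') + 1 + 1) := by rw [hj]
        rw [this]; ring
      omega

end IsOptimal

end

/-! ### Structure of the leftover forest and the contradiction -/

section

variable {V : Type*} {G : SimpleGraph V} {A B X Z Z' : Finset V} {v w x y z a b : V} {j : ℕ}
variable [Fintype V]

namespace IsOptimal

variable {S : Fin j → Finset V} {i i' : Fin j} {t c k : ℕ}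

/-- If all cycles are longer, each vertex of the forest sends at most one edge to each. The larger
colour class `A` has at least `t` vertices and fewer than `2|A|` edges into the forest, so its mean
degree is below `2 + j`. -/
lemma exists_card_le_four (h : IsOptimal G S) (ht : 1 ≤ t) (hk : 2 ≤ k) (hj : j + 1 ≤ k)
    (hc : c + t = 2 * k * t + 1)
    (hdeg : ∀ X, Indep G X → #X = t → c ≤ ∑ x ∈ X, dIn G univ x)
    (hr : 2 * t - 1 ≤ #(rest S)) : ∃ i, #(S i) ≤ 4 := by
  by_contra! h5
  have key : ∀ A B : Finset V, Disjoint A B → A ∪ B = rest S → Indep G A → Indep G B →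
      #B ≤ #A → False := by
    intro A B hAB hU hA hB hle
    have hAr : A ⊆ rest S := by rw [← hU]; exact subset_union_left
    have hcard : #(rest S) = #A + #B := by rw [← hU, card_union_of_disjoint hAB]
    have hzero : ∀ A : Finset V, Indep G A → edgePairs G A A = 0 := by
      intro A hA
      exact sum_eq_zero fun v hv => dIn_eq_zero_iff.2 fun w hw => hA v hv w hw
    have h1 := mul_card_le_of_forall_subset ht (dIn G univ) A (by omega)
      fun X hX hXt => hdeg X (hA.mono hX) hXt
    rw [h.sum_dIn_univ] at h1
    have h2 : edgePairs G A (rest S) ≤ 2 * #A := by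
      have e1 : edgePairs G A (rest S) = edgePairs G A B := by
        rw [← hU, edgePairs_union_right hAB, hzero A hA, zero_add]
      have e2 := edgePairs_add_two_le h.not_cyclic_rest (card_pos.1 (by omega))
      rw [hcard, ← hU, edgePairs_union_self hAB, hzero A hA, hzero B hB] at e2
      omega
    have h3 : ∑ i, edgePairs G A (S i) ≤ ∑ _i : Fin j, #A :=
      sum_le_sum fun i _ => h.edgePairs_le_of_five_le_card hAr (h5 i)
    simp only [sum_const, card_univ, Fintype.card_fin, smul_eq_mul] at h3
    have h4 : #A * c ≤ #A * (t * (2 + j)) :=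
      h1.trans ((Nat.mul_le_mul_left t (Nat.add_le_add h2 h3)).trans_eq (by ring))
    have h6 := le_of_mul_le_mul_left h4 (show 0 < #A by omega)
    -- Here `h6` gives `c ≤ t * (2 + j) ≤ t * (k + 1)`, while `c = (2k - 1)t + 1`; this is where `k
    -- ≥ 2` enters.
    nlinarith
  obtain ⟨A, B, hAB, hU, hA, hB⟩ := exists_bipartition h.not_cyclic_rest
  rcases le_total #B #A with hle | hle
  · exact key A B hAB hU hA hB hle
  · exact key B A hAB.symm (by rw [union_comm, hU]) hB hA hle

/-- Three neighbours force a triangle, and `x` may replace any vertex `v` of it. As the swap gains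
no edges in the complement, `v` has at most `r + 1` neighbours there. -/
lemma edgePairs_le_of_three_le (h : IsOptimal G S) {r : ℕ} (hx : x ∈ rest S)
    (hr : dIn G (rest S) x ≤ r) (h3 : 3 ≤ dIn G (S i) x) (hX : X ⊆ rest S) :
    edgePairs G X (S i) ≤ 3 * (r + 1) := by
  have hcard : #(S i) ≤ 3 := by
    by_contra! hc
    have := h.dIn_le_two hx hc
    omega
  rw [edgePairs_comm]
  have h1 : edgePairs G (S i) X ≤ ∑ v ∈ S i, (r + 1) := by
    refine sum_le_sum fun v hv => ?_
    have e1 := dIn_le_erase_add_one (G := G) (S i) x v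
    have e2 := h.dIn_le_of_swap i hx hv (by omega)
    have e3 := dIn_le_erase_add_one (G := G) (rest S) v x
    have e4 := dIn_mono (G := G) hX v
    omega
  rw [sum_const, smul_eq_mul] at h1
  exact h1.trans (Nat.mul_le_mul_right _ hcard)

/-- A `t`-subset has over `2jt` edges to the cycles, so one cycle gets more than `2t` of them and
some vertex sends it three. Then `edgePairs_le_of_three_le` allows at most six edges, fewer than
`2t`. -/
lemma card_lt_of_dIn_le_one (h : IsOptimal G S) (ht : 5 ≤ t) (hc : 2 * j * t + t + 1 ≤ c)
    (hdeg : ∀ X, Indep G X → #X = t → c ≤ ∑ x ∈ X, dIn G univ x) (hX : X ⊆ rest S)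
    (hI : Indep G X) (h1 : ∀ x ∈ X, dIn G (rest S) x ≤ 1) : #X < t := by
  by_contra! hle
  obtain ⟨Y, hYX, hYt⟩ := exists_subset_card_eq hle
  have h2 := hc.trans (hdeg Y (hI.mono hYX) hYt)
  rw [h.sum_dIn_univ] at h2
  have h3 : edgePairs G Y (rest S) ≤ ∑ x ∈ Y, 1 := sum_le_sum fun x hx => h1 x (hYX hx)
  simp only [sum_const, smul_eq_mul, mul_one] at h3
  obtain ⟨i, hi⟩ : ∃ i, 2 * t < edgePairs G Y (S i) := by
    by_contra! hall
    have h4 : ∑ i, edgePairs G Y (S i) ≤ ∑ _i : Fin j, 2 * t := sum_le_sum fun i _ => hall i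
    simp only [sum_const, card_univ, Fintype.card_fin, smul_eq_mul] at h4
    nlinarith
  obtain ⟨x, hx, h5⟩ : ∃ x ∈ Y, 3 ≤ dIn G (S i) x := by
    by_contra! hall
    have h4 : edgePairs G Y (S i) ≤ ∑ x ∈ Y, 2 :=
      sum_le_sum fun x hx => by have := hall x hx; omega
    simp only [sum_const, smul_eq_mul] at h4
    omega
  have := h.edgePairs_le_of_three_le (hX (hYX hx)) (h1 x (hYX hx)) h5 (hYX.trans hX)
  omega

/-- The isolated vertices together with the larger half of the degree-one vertices form an
independent set, of size below `t`; its double bounds the weight. -/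
lemma leafWeight_rest_add_two_le (h : IsOptimal G S) (ht : 5 ≤ t) (hc : 2 * j * t + t + 1 ≤ c)
    (hdeg : ∀ X, Indep G X → #X = t → c ≤ ∑ x ∈ X, dIn G univ x) :
    leafWeight G (rest S) + 2 ≤ 2 * t := by
  set V₀ := {v ∈ rest S | dIn G (rest S) v = 0} with hV₀
  set V₁ := {v ∈ rest S | dIn G (rest S) v = 1} with hV₁
  have hs₀ : V₀ ⊆ rest S := filter_subset _ _
  have hs₁ : V₁ ⊆ rest S := filter_subset _ _
  have hw : leafWeight G (rest S) = 2 * #V₀ + #V₁ := by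
    rw [hV₀, hV₁, card_filter, card_filter, mul_sum, ← sum_add_distrib]
    refine sum_congr rfl fun v _ => ?_
    split_ifs <;> omega
  obtain ⟨A, B, hAB, hU, hA, -, h1, h2⟩ := exists_balanced_bipartition (G := G) (S := V₁)
    (fun hc => h.not_cyclic_rest (hc.mono hs₁)) fun v hv => by
      have := dIn_mono (G := G) hs₁ v
      rw [hV₁, mem_filter] at hv
      omega
  have hA₁ : A ⊆ V₁ := by rw [← hU]; exact subset_union_left
  have hcard : #V₁ = #A + #B := by rw [← hU, card_union_of_disjoint hAB]
  have hd : Disjoint V₀ A := by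
    refine Disjoint.mono_right hA₁ (disjoint_filter.2 fun v _ h0 h1 => ?_)
    omega
  have h0 : ∀ v ∈ V₀, ∀ w ∈ rest S, ¬ G.Adj v w := by
    intro v hv
    rw [hV₀, mem_filter] at hv
    exact dIn_eq_zero_iff.1 hv.2
  have hlt := h.card_lt_of_dIn_le_one ht hc hdeg (X := V₀ ∪ A)
    (union_subset hs₀ (hA₁.trans hs₁)) ?_ ?_
  · rw [card_union_of_disjoint hd] at hlt
    omega
  · intro x hx y hy
    rw [mem_union] at hx hy
    rcases hx with hx | hx
    · rcases hy with hy | hy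
      · exact h0 x hx y (hs₀ hy)
      · exact h0 x hx y (hs₁ (hA₁ hy))
    · rcases hy with hy | hy
      · exact fun hc => h0 y hy x (hs₁ (hA₁ hx)) hc.symm
      · exact hA x hx y hy
  · intro x hx
    rcases mem_union.1 hx with hx | hx
    · rw [hV₀, mem_filter] at hx; omega
    · have := hA₁ hx
      rw [hV₁, mem_filter] at this; omega

lemma card_branch_add_three_le (h : IsOptimal G S) (ht : 5 ≤ t) (hc : 2 * j * t + t + 1 ≤ c)
    (hdeg : ∀ X, Indep G X → #X = t → c ≤ ∑ x ∈ X, dIn G univ x) :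
    #{v ∈ rest S | ¬ dIn G (rest S) v ≤ 2} + 3 ≤ t := by
  set H := rest S with hH
  set b := {v ∈ H | ¬ dIn G H v ≤ 2} with hb
  rcases b.eq_empty_or_nonempty with h0 | ⟨u, hu⟩
  · rw [h0, card_empty]; omega
  -- discard the components with at most two vertices
  set R := {v ∈ H | dIn G H v ≠ 0 ∧ (dIn G H v = 1 → ∀ w ∈ H, G.Adj v w → dIn G H w ≠ 1)} with hR
  have hRH : R ⊆ H := filter_subset _ _
  have hdR : ∀ v ∈ R, dIn G R v = dIn G H v := by
    intro v hv
    apply le_antisymm (dIn_mono hRH v)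
    apply card_le_card
    intro w hw
    rw [mem_filter] at hw ⊢
    rw [hR, mem_filter] at hv
    refine ⟨?_, hw.2⟩
    rw [hR, mem_filter]
    refine ⟨hw.1, (dIn_pos_iff.2 ⟨v, hv.1, hw.2.symm⟩).ne', fun h1 z hz hwz h2 => ?_⟩
    have hzv : z = v := by
      by_contra hne
      have := two_le_dIn_iff.2 ⟨z, hz, v, hv.1, hne, hwz, hw.2.symm⟩
      omega
    subst hzv
    exact hv.2.2 h2 w hw.1 hw.2 h1
  have hbR : b ⊆ R := by
    intro v hv
    rw [hb, mem_filter] at hv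
    rw [hR, mem_filter]
    exact ⟨hv.1, by omega, by omega⟩
  have h1 := edgePairs_add_two_le (G := G) (S := R)
    (fun hc => h.not_cyclic_rest (hc.mono hRH)) ⟨u, hbR hu⟩
  set L := {v ∈ R | dIn G H v = 1} with hL
  -- In a forest without isolated vertices, `2|R|` plus the number of branch vertices is at most the
  -- degree sum plus the number of leaves. With no single-edge components left, the leaves `L` are
  -- independent, hence fewer than `t`.
  have h2 : ∑ v ∈ R, (2 + if ¬ dIn G H v ≤ 2 then 1 else 0) ≤
      ∑ v ∈ R, (dIn G R v + if dIn G H v = 1 then 1 else 0) := by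
    refine sum_le_sum fun v hv => ?_
    rw [hdR v hv]
    rw [hR, mem_filter] at hv
    have := hv.2.1
    split_ifs <;> omega
  rw [sum_add_distrib, sum_add_distrib, ← card_filter, ← card_filter, sum_const, smul_eq_mul,
    ← hL] at h2
  have h3 : #b ≤ #{v ∈ R | ¬ dIn G H v ≤ 2} := by
    apply card_le_card
    intro v hv
    have := hbR hv
    rw [hb, mem_filter] at hv
    exact mem_filter.2 ⟨this, hv.2⟩
  have h4 : #L < t := by
    refine h.card_lt_of_dIn_le_one ht hc hdeg ((filter_subset _ _).trans hRH) ?_ ?_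
    · intro x hx y hy hxy
      rw [hL, mem_filter] at hx hy
      have hx' := hx.1
      rw [hR, mem_filter] at hx'
      exact hx'.2.2 hx.2 y (hRH hy.1) hxy hy.2
    · intro x hx
      rw [hL, mem_filter] at hx
      exact hx.2.le
  have h5 : ∑ v ∈ R, dIn G R v = edgePairs G R R := rfl
  omega

lemma two_le_leafWeight_rest (h : IsOptimal G S) (hne : (rest S).Nonempty) :
    2 ≤ leafWeight G (rest S) := by
  have h1 := edgePairs_add_two_le h.not_cyclic_rest hne
  have h2 : ∑ v ∈ rest S, 2 ≤ ∑ v ∈ rest S, (dIn G (rest S) v + (2 - dIn G (rest S) v)) :=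
    sum_le_sum fun v _ => by omega
  rw [sum_add_distrib, sum_const, smul_eq_mul] at h2
  unfold edgePairs at h1
  unfold leafWeight
  omega

/-- Too many common neighbours of `a` and `b` would give two disjoint subtrees; closing one with `a`
and the other with `b` turns one cycle into two. -/
lemma card_lt_of_forall_adj (h : IsOptimal G S) {D : Finset V} (hD : D ⊆ rest S) (ha : a ∈ S i)
    (hb : b ∈ S i) (hab : a ≠ b) (hDa : ∀ x ∈ D, G.Adj x a) (hDb : ∀ x ∈ D, G.Adj x b) :
    #D < leafWeight G (rest S) + 2 := by
  by_contra! hc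
  obtain ⟨Z, Z', hZ, hZ', hd, hT, hT', h2, h2'⟩ := exists_two_treeLike h.not_cyclic_rest hD hc
  have hr : ∀ a ∈ S i, a ∉ rest S := fun a ha => disjoint_left.1 (disjoint_rest S i) ha
  have key : ∀ Z : Finset V, ∀ a, 2 ≤ #(Z ∩ D) → (∀ x ∈ D, G.Adj x a) → 2 ≤ dIn G Z a := by
    intro Z a h2 hDa
    refine h2.trans (card_le_card fun x hx => ?_)
    rw [mem_inter] at hx
    exact mem_filter.2 ⟨hx.1, (hDa x hx.2).symm⟩
  refine h.not_two_cyclic i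
    (cyclic_insert hT (fun hc => hr a ha (hZ hc)) (key Z a h2 hDa))
    (cyclic_insert hT' (fun hc => hr b hb (hZ' hc)) (key Z' b h2' hDb)) ?_
    (insert_subset (mem_union_left _ ha) (hZ.trans subset_union_right))
    (insert_subset (mem_union_left _ hb) (hZ'.trans subset_union_right))
  rw [disjoint_insert_left, disjoint_insert_right, mem_insert, not_or]
  exact ⟨⟨hab, fun hc => hr a ha (hZ' hc)⟩, fun hc => hr b hb (hZ hc), hd⟩

/-- If vertices of degree at most two attach to a short cycle in two different ways, then only few
of them have two neighbours on it. -/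
lemma card_le_four_of_not_adj (h : IsOptimal G S) {D : Finset V} (hD : D ⊆ rest S)
    (hD2 : ∀ x ∈ D, dIn G (rest S) x ≤ 2 ∧ dIn G (S i) x = 2) (h4 : #(S i) ≤ 4)
    (ha : a ∈ S i) (hb : b ∈ S i) (hab : a ≠ b) (hx : x ∈ D) (hxa : G.Adj x a) (hxb : G.Adj x b)
    (hy : y ∈ D) (hyb : ¬ G.Adj y b) : #D ≤ 4 := by
  set U := {v ∈ S i | dIn G D v ≤ 2} with hU
  have hUS : U ⊆ S i := filter_subset _ _
  -- If `x` misses `v`, both its cycle neighbours survive the removal of `v`, so the swap is allowed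
  -- and bounds the degree of `v` by that of `x`.
  have hmemU : ∀ x ∈ D, ∀ v ∈ S i, ¬ G.Adj x v → v ∈ U := by
    intro x hx v hv hxv
    obtain ⟨h1, h2⟩ := hD2 x hx
    have e1 := dIn_erase_add (G := G) hv x
    rw [if_neg hxv] at e1
    have e2 := h.dIn_le_of_swap i (hD hx) hv (by omega)
    have e3 := dIn_erase_add (G := G) (hD hx) v
    rw [if_neg fun hc => hxv hc.symm] at e3
    have e4 := dIn_mono (G := G) hD v
    exact mem_filter.2 ⟨hv, by omega⟩
  have hnb : ∀ v ∈ S i, G.Adj x v → v = a ∨ v = b := by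
    intro v hv hxv
    by_contra! hc
    have h3 : 3 ≤ dIn G (S i) x := by
      have hsub : ({a, b, v} : Finset V) ⊆ {u ∈ S i | G.Adj x u} := by
        intro u hu
        simp only [mem_insert, mem_singleton] at hu
        rw [mem_filter]
        rcases hu with rfl | rfl | rfl
        · exact ⟨ha, hxa⟩
        · exact ⟨hb, hxb⟩
        · exact ⟨hv, hxv⟩
      have := card_le_card hsub
      rwa [card_eq_three.2 ⟨_, _, _, hab, hc.1.symm, hc.2.symm, rfl⟩] at this
    have := (hD2 x hx).2
    omega
  have hQ : S i \ U ⊆ {a} := by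
    intro v hv
    rw [mem_sdiff] at hv
    rw [mem_singleton]
    have hxv : G.Adj x v := by
      by_contra hc
      exact hv.2 (hmemU x hx v hv.1 hc)
    rcases hnb v hv.1 hxv with rfl | rfl
    · rfl
    · exact absurd (hmemU y hy v hv.1 hyb) hv.2
  have hcardQ := card_sdiff_add_card_eq_card hUS
  have hUD : edgePairs G D U ≤ 2 * #U := by
    rw [edgePairs_comm]
    have : edgePairs G U D ≤ ∑ v ∈ U, 2 := sum_le_sum fun v hv => by
      rw [hU, mem_filter] at hv
      exact hv.2
    rw [sum_const, smul_eq_mul] at this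
    omega
  -- Only `a` can lie outside `U`. If it does not, `2|D| ≤ 2 * #(S i) ≤ 8`. If it does, the cycle is
  -- shown to be a triangle, and each vertex of `D` has a neighbour among the two vertices of `U`,
  -- so `|D| ≤ 4`.
  by_cases haU : a ∈ U
  · have hUeq : U = S i := by
      apply subset_antisymm hUS
      intro v hv
      by_contra hc
      have := mem_singleton.1 (hQ (mem_sdiff.2 ⟨hv, hc⟩))
      exact hc (this ▸ haU)
    have : ∑ x ∈ D, 2 = edgePairs G D U := by
      rw [hUeq]
      exact sum_congr rfl fun x hx => (hD2 x hx).2.symm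
    rw [sum_const, smul_eq_mul] at this
    rw [hUeq] at this hUD
    omega
  · have hq1 : #(S i \ U) = 1 := by
      have := card_le_card hQ
      rw [card_singleton] at this
      have : 0 < #(S i \ U) := card_pos.2 ⟨a, mem_sdiff.2 ⟨ha, haU⟩⟩
      omega
    have h3 : #(S i) ≤ 3 := by
      by_contra! hc
      have hya : G.Adj y a := by
        by_contra hc
        exact haU (hmemU y hy a ha hc)
      obtain ⟨w, hw, hyw⟩ : ∃ w ∈ (S i).erase a, G.Adj y w := by
        rw [← dIn_pos_iff]
        have := dIn_le_erase_add_one (G := G) (S i) y a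
        have := (hD2 y hy).2
        omega
      rw [mem_erase] at hw
      have hwb : w ≠ b := fun hc => hyb (hc ▸ hyw)
      -- On a 4-cycle `a` would be non-adjacent to both `b` and `w`, leaving only one possible
      -- neighbour.
      have n1 := h.not_adj_of_adj_of_adj (hD hx) hc ha hb hxa hxb
      have n2 := h.not_adj_of_adj_of_adj (hD hy) hc ha hw.2 hya hyw
      have hsub : {u ∈ S i | G.Adj a u} ⊆ S i \ {a, b, w} := by
        intro u hu
        rw [mem_filter] at hu
        simp only [mem_sdiff, mem_insert, mem_singleton, not_or]
        refine ⟨hu.1, ?_, ?_, ?_⟩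
        · rintro rfl; exact G.ne_of_adj hu.2 rfl
        · rintro rfl; exact n1 hu.2
        · rintro rfl; exact n2 hu.2
      have e1 := card_le_card hsub
      have e2 := (h.minCyclic i).dIn_eq a ha
      unfold dIn at e2
      have hsub' : ({a, b, w} : Finset V) ⊆ S i := by
        simp [insert_subset_iff, ha, hb, hw.2]
      have e3 := card_sdiff_add_card_eq_card hsub'
      rw [card_eq_three.2 ⟨_, _, _, hab, hw.1.symm, hwb.symm, rfl⟩] at e3
      omega
    have hDU : ∑ x ∈ D, 1 ≤ edgePairs G D U := by
      refine sum_le_sum fun x hx => ?_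
      have e1 := (hD2 x hx).2
      rw [← union_sdiff_of_subset hUS, dIn_union disjoint_sdiff] at e1
      have e2 := dIn_le_card (G := G) (S i \ U) x
      omega
    rw [sum_const, smul_eq_mul] at hDU
    omega

/-- Long cycles receive at most one edge per vertex, and a vertex with three neighbours caps the
total at nine. Otherwise the excess over `|W|` is the number of vertices with two neighbours. It is
at most `Λ + 1` if these share the same pair, and at most `4 ≤ Λ + 2` if not. -/
lemma edgePairs_le_add_leafWeight (h : IsOptimal G S)
    (h10 : 10 ≤ #{v ∈ rest S | dIn G (rest S) v ≤ 2}) :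
    edgePairs G {v ∈ rest S | dIn G (rest S) v ≤ 2} (S i) ≤
      #{v ∈ rest S | dIn G (rest S) v ≤ 2} + leafWeight G (rest S) + 2 := by
  set W := {v ∈ rest S | dIn G (rest S) v ≤ 2} with hW
  have hWr : W ⊆ rest S := filter_subset _ _
  have hW2 : ∀ x ∈ W, dIn G (rest S) x ≤ 2 := fun x hx => (mem_filter.1 hx).2
  rcases Nat.lt_or_ge 4 #(S i) with h5 | h4
  · have := h.edgePairs_le_of_five_le_card hWr h5
    omega
  by_cases htri : ∃ x ∈ W, 3 ≤ dIn G (S i) x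
  · obtain ⟨x, hx, h3⟩ := htri
    have := h.edgePairs_le_of_three_le (hWr hx) (hW2 x hx) h3 hWr
    omega
  push Not at htri
  have hΛ := h.two_le_leafWeight_rest ((card_pos.1 (by omega : 0 < #W)).mono hWr)
  set D := {x ∈ W | dIn G (S i) x = 2} with hD
  have hDr : D ⊆ rest S := (filter_subset _ _).trans hWr
  have hD2 : ∀ x ∈ D, dIn G (rest S) x ≤ 2 ∧ dIn G (S i) x = 2 := fun x hx =>
    ⟨hW2 x (mem_filter.1 hx).1, (mem_filter.1 hx).2⟩
  have h1 : edgePairs G W (S i) ≤ ∑ x ∈ W, (1 + if dIn G (S i) x = 2 then 1 else 0) :=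
    sum_le_sum fun x hx => by
      have := htri x hx
      split_ifs <;> omega
  rw [sum_add_distrib, ← card_filter, sum_const, smul_eq_mul, ← hD] at h1
  suffices #D ≤ leafWeight G (rest S) + 2 by omega
  rcases D.eq_empty_or_nonempty with h0 | ⟨x, hx⟩
  · simp [h0]
  obtain ⟨a, ha, b, hb, hab, hxa, hxb⟩ := two_le_dIn_iff.1 (hD2 x hx).2.ge
  by_cases hall : ∀ y ∈ D, G.Adj y a ∧ G.Adj y b
  · have := h.card_lt_of_forall_adj hDr ha hb hab (fun y hy => (hall y hy).1)
      fun y hy => (hall y hy).2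
    omega
  · push Not at hall
    obtain ⟨y, hy, hyn⟩ := hall
    have : #D ≤ 4 := by
      by_cases hya : G.Adj y a
      · exact h.card_le_four_of_not_adj hDr hD2 h4 ha hb hab hx hxa hxb hy (hyn hya)
      · exact h.card_le_four_of_not_adj hDr hD2 h4 hb ha hab.symm hx hxb hxa hy hya
    omega

theorem absurd_of_degree_sum (h : IsOptimal G S) (ht : 5 ≤ t) (hk : 2 ≤ k) (hj : j + 1 ≤ k)
    (hc : c + t = 2 * k * t + 1)
    (hdeg : ∀ X, Indep G X → #X = t → c ≤ ∑ x ∈ X, dIn G univ x)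
    (hn : (2 * t - 1) * k ≤ Fintype.card V) : False := by
  have hc' : 2 * j * t + t + 1 ≤ c := by nlinarith
  have hn' := (Nat.mul_le_mul_left (2 * t - 1) hj).trans hn
  obtain ⟨hr, hr'⟩ := h.card_rest ht hc' hdeg hn'
  obtain ⟨i, hi⟩ := h.exists_card_le_four (by omega) hk hj hc hdeg hr
  have hrest := hr' ⟨i, hi⟩
  have hΛ := h.leafWeight_rest_add_two_le ht hc' hdeg
  have hbr := h.card_branch_add_three_le ht hc' hdeg
  have hsplit := card_filter_add_card_filter_not (s := rest S) (fun v => dIn G (rest S) v ≤ 2)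
  have hup : ∀ i, _ := fun i => h.edgePairs_le_add_leafWeight (i := i) (by omega)
  set W := {v ∈ rest S | dIn G (rest S) v ≤ 2} with hW
  have hWr : W ⊆ rest S := filter_subset _ _
  -- From `|H| ≥ 4t - 6` and at most `t - 3` branch vertices, `|W| ≥ 3t - 3`; hence both halves of a
  -- balanced bipartition have at least `t` vertices.
  have hN : 2 * t + 1 ≤ #W := by omega
  obtain ⟨A, B, hAB, hU, hA, hB, h1, h2⟩ := exists_balanced_bipartition (G := G) (S := W)
    (fun hc => h.not_cyclic_rest (hc.mono hWr))
    fun v hv => (dIn_mono hWr v).trans (mem_filter.1 hv).2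
  have hcard : #W = #A + #B := by rw [← hU, card_union_of_disjoint hAB]
  have hlow : #W * c ≤ t * ∑ x ∈ W, dIn G univ x := by
    have e1 := mul_card_le_of_forall_subset (by omega) (dIn G univ) A (by omega)
      fun X hX hXt => hdeg X (hA.mono hX) hXt
    have e2 := mul_card_le_of_forall_subset (by omega) (dIn G univ) B (by omega)
      fun X hX hXt => hdeg X (hB.mono hX) hXt
    have e3 : ∑ x ∈ W, dIn G univ x = ∑ x ∈ A, dIn G univ x + ∑ x ∈ B, dIn G univ x := by
      rw [← hU, sum_union hAB]
    rw [hcard, e3, add_mul, mul_add]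
    omega
  rw [h.sum_dIn_univ] at hlow
  have hself : edgePairs G W (rest S) + leafWeight G (rest S) = 2 * #W := by
    have e1 : leafWeight G (rest S) = ∑ v ∈ W, (2 - dIn G (rest S) v) := by
      rw [hW, sum_filter]
      refine sum_congr rfl fun v _ => ?_
      split_ifs <;> omega
    have e2 : edgePairs G W (rest S) = ∑ v ∈ W, dIn G (rest S) v := rfl
    rw [e1, e2, ← sum_add_distrib, sum_congr rfl fun v hv =>
      Nat.add_sub_cancel' (mem_filter.1 hv).2, sum_const, smul_eq_mul, mul_comm]
  have hsum := sum_le_sum fun i (_ : i ∈ (univ : Finset (Fin j))) => hup i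
  simp only [sum_const, card_univ, Fintype.card_fin, smul_eq_mul] at hsum
  have hj0 : 0 < j := i.pos
  obtain ⟨m, rfl⟩ : ∃ m, j = m + 1 := ⟨j - 1, by omega⟩
  have hfin := (Nat.mul_le_mul_left #W hc').trans
    (hlow.trans (Nat.mul_le_mul_left t (Nat.add_le_add_left hsum _)))
  generalize edgePairs G W (rest S) = E at *
  generalize leafWeight G (rest S) = Λ at *
  generalize #W = N at *
  -- For one cycle the surplus `Λ` cancels against the deficit in `E = 2N - Λ`; for the other `m`
  -- cycles `Λ + 2 ≤ N` suffices. What remains is `N ≤ 2t`.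
  have h3 : m * (Λ + 2) ≤ m * N := Nat.mul_le_mul_left _ (by omega)
  have h4 : t * (m * (Λ + 2)) ≤ t * (m * N) := Nat.mul_le_mul_left _ h3
  have h5 : t * (E + Λ) = t * (2 * N) := by rw [hself]
  nlinarith

end IsOptimal

end

/-! ### The degree sum theorem -/

section

variable {V : Type*} {G : SimpleGraph V} {X : Finset V} {t k : ℕ}

lemma dIn_univ_eq_degree [Fintype V] (v : V) [Fintype (G.neighborSet v)] :
    dIn G univ v = G.degree v := by
  rw [← SimpleGraph.card_neighborFinset_eq_degree]
  unfold dIn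
  congr 1
  ext w
  simp

lemma Indep.isNIndepSet (h : Indep G X) (ht : #X = t) : G.IsNIndepSet t X :=
  ⟨fun x hx y hy _ => h x (by simpa using hx) y (by simpa using hy), ht⟩

theorem hasDisjointCycles_of_le_sigma [Fintype V] (ht : 5 ≤ t) (hk : 2 ≤ k)
    (hn : (2 * t - 1) * k ≤ Fintype.card V)
    (hσ : ((2 * k * t - t + 1 : ℕ) : ℕ∞) ≤ sigma G t) : HasDisjointCycles G k := by
  have hdeg : ∀ X, Indep G X → #X = t → 2 * k * t - t + 1 ≤ ∑ x ∈ X, dIn G univ x := by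
    intro X hX hXt
    have h1 := hσ.trans (iInf_le _ (⟨X, hX.isNIndepSet hXt⟩ : {X // G.IsNIndepSet t X}))
    rw [Nat.cast_le] at h1
    simpa only [dIn_univ_eq_degree] using h1
  -- Packings are enlarged one cycle at a time; a packing that cannot be enlarged is replaced by an
  -- optimal one, which is contradictory.
  have key : ∀ j ≤ k, ∃ S : Fin j → Finset V, IsPacking G S := by
    intro j
    induction j with
    | zero => exact fun _ => ⟨fun i => i.elim0, fun i => i.elim0, fun i => i.elim0⟩
    | succ j ih =>
      intro hj
      obtain ⟨S, hS⟩ := ih (by omega)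
      by_contra! hno
      obtain ⟨S', hS'⟩ := exists_isOptimal hS hno
      refine hS'.absurd_of_degree_sum ht hk hj ?_ hdeg hn
      have : t ≤ 2 * k * t := Nat.le_mul_of_pos_left t (by omega)
      omega
  obtain ⟨S, hS⟩ := key k le_rfl
  exact hS.hasDisjointCycles

/-! ### Sharpness -/

variable {n m : ℕ}

lemma completeJoinEmpty_adj_inl (a : Fin n) (y : Fin n ⊕ Fin m) :
    (completeJoinEmpty n m).Adj (.inl a) y ↔ y ≠ .inl a := by
  cases y <;> simp [completeJoinEmpty, join, eq_comm]

lemma completeJoinEmpty_not_adj_inr (a b : Fin m) :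
    ¬ (completeJoinEmpty n m).Adj (.inr a) (.inr b) := by
  simp [completeJoinEmpty, join]

lemma dIn_completeJoinEmpty_inr (a : Fin m) :
    dIn (completeJoinEmpty n m) univ (.inr a) = n := by
  have : ({w ∈ univ | (completeJoinEmpty n m).Adj (.inr a) w} : Finset (Fin n ⊕ Fin m)) =
      univ.map ⟨Sum.inl, Sum.inl_injective⟩ := by
    ext w
    cases w with
    | inl b => simp [SimpleGraph.adj_comm _ (Sum.inr a), completeJoinEmpty_adj_inl]
    | inr b => simp [completeJoinEmpty_not_adj_inr]
  unfold dIn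
  rw [this, card_map, card_univ, Fintype.card_fin]

/-- An independent set with two or more vertices avoids the clique, and every other vertex has
degree exactly `n`. -/
lemma sigma_completeJoinEmpty (ht : 2 ≤ t) (hm : t ≤ m) :
    sigma (completeJoinEmpty n m) t = ((t * n : ℕ) : ℕ∞) := by
  unfold sigma
  apply le_antisymm
  · obtain ⟨Y, -, hY⟩ := exists_subset_card_eq (s := (univ : Finset (Fin m))) (n := t) (by simpa)
    have hI : Indep (completeJoinEmpty n m) (Y.map ⟨Sum.inr, Sum.inr_injective⟩) := by
      intro x hx y hy
      simp only [mem_map, Function.Embedding.coeFn_mk] at hx hy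
      obtain ⟨a, -, rfl⟩ := hx
      obtain ⟨b, -, rfl⟩ := hy
      exact completeJoinEmpty_not_adj_inr a b
    refine (iInf_le _ (⟨_, hI.isNIndepSet (by rw [card_map, hY])⟩ :
      {X // (completeJoinEmpty n m).IsNIndepSet t X})).trans (le_of_eq ?_)
    simp only [← dIn_univ_eq_degree, sum_map, Function.Embedding.coeFn_mk,
      dIn_completeJoinEmpty_inr, sum_const, hY, smul_eq_mul]
  · refine le_iInf fun ⟨X, hX, hXt⟩ => ?_
    rw [Nat.cast_le]
    simp only [← dIn_univ_eq_degree]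
    have : ∀ x ∈ X, dIn (completeJoinEmpty n m) univ x = n := by
      intro x hx
      cases x with
      | inr a => exact dIn_completeJoinEmpty_inr a
      | inl a =>
        obtain ⟨y, hy, hne⟩ := exists_mem_ne (show 1 < #X by omega) (Sum.inl a)
        exact absurd ((completeJoinEmpty_adj_inl a y).2 hne)
          (hX (by simpa using hx) (by simpa using hy) hne.symm)
    rw [sum_congr rfl this, sum_const, hXt, smul_eq_mul]

/-- Outside the clique the graph has no edges, so each cycle uses at least two clique vertices, and
`k` disjoint cycles would need `2k` of them. -/
lemma not_hasDisjointCycles_completeJoinEmpty (hn : n < 2 * k) :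
    ¬ HasDisjointCycles (completeJoinEmpty n m) k := by
  rintro ⟨v, c, hc, hd⟩
  let T : Fin k → Finset (Fin n) := fun i => {a | Sum.inl a ∈ (c i).support}
  have hT : ∀ i, 2 ≤ #(T i) := by
    intro i
    have hinr : ∀ a, Sum.inr a ∈ (c i).support → 2 ≤ #(T i) := by
      intro a ha
      obtain ⟨x, hx, y, hy, hxy, hax, hay⟩ := two_le_dIn_iff.1 (two_le_dIn_support (hc i) ha)
      cases x with
      | inr x => exact absurd hax (completeJoinEmpty_not_adj_inr a x)
      | inl x =>
        cases y with
        | inr y => exact absurd hay (completeJoinEmpty_not_adj_inr a y)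
        | inl y =>
          exact one_lt_card.2 ⟨x, by simpa [T] using hx, y, by simpa [T] using hy,
            fun h => hxy (by rw [h])⟩
    have hv : v i ∈ (c i).support := (c i).start_mem_support
    cases hvi : v i with
    | inr a => exact hinr a (hvi ▸ hv)
    | inl a =>
      obtain ⟨x, hx, y, hy, hxy, hax, hay⟩ := two_le_dIn_iff.1 (two_le_dIn_support (hc i) hv)
      cases x with
      | inr x => exact hinr x (by simpa using hx)
      | inl x =>
        refine one_lt_card.2 ⟨x, by simpa [T] using hx, a, by simp [T, ← hvi], ?_⟩
        rintro rfl
        rw [hvi] at hax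
        exact (completeJoinEmpty n m).loopless.irrefl _ hax
  have hdis : ∀ i ∈ (univ : Finset (Fin k)), ∀ i' ∈ (univ : Finset (Fin k)), i ≠ i' →
      Disjoint (T i) (T i') := by
    intro i _ i' _ hne
    rw [disjoint_left]
    intro a ha ha'
    exact hd i i' hne (by simpa [T] using ha) (by simpa [T] using ha')
  have h1 : ∑ _i : Fin k, 2 ≤ ∑ i, #(T i) := sum_le_sum fun i _ => hT i
  rw [← card_biUnion hdis] at h1
  have h2 := card_le_univ (univ.biUnion T)
  simp only [sum_const, card_univ, Fintype.card_fin, smul_eq_mul] at h1 h2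
  omega

end

end DisjointCycles

theorem mainTheorem1 (k t : ℕ) (hk : 2 ≤ k) (ht : 5 ≤ t) :
    (∀ (V : Type*) [Fintype V] (G : SimpleGraph V),
      (2 * t - 1) * k ≤ Fintype.card V →
      ((2 * k * t - t + 1 : ℕ) : ℕ∞) ≤ DisjointCycles.sigma G t →
      DisjointCycles.HasDisjointCycles G k) ∧
    (∀ m : ℕ, t ≤ m →
      DisjointCycles.sigma (DisjointCycles.completeJoinEmpty (2 * k - 1) m) t
          = ((2 * k * t - t : ℕ) : ℕ∞) ∧
        ¬ DisjointCycles.HasDisjointCycles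
            (DisjointCycles.completeJoinEmpty (2 * k - 1) m) k) := by
  refine ⟨fun V _ G hn hσ => DisjointCycles.hasDisjointCycles_of_le_sigma ht hk hn hσ,
    fun m hm => ⟨?_, DisjointCycles.not_hasDisjointCycles_completeJoinEmpty (by omega)⟩⟩
  rw [DisjointCycles.sigma_completeJoinEmpty (by omega) hm]
  congr 1
  rw [Nat.mul_sub, mul_one]
  congr 1
  ring
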